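/- Let $L$ be a countable vocabulary and let $\varphi_\kappa$ be a complete sentence of $L_{\omega_1,\omega}(L)$ that homogeneously characterizes the infinite cardinal $\kappa$ with absolute indiscernibles in the unary predicate $P\in L$. This means: (a) $\varphi_\kappa$ has no model of size $\kappa^+$; (b) in the countable model $\mathcal M$ of $\varphi_\kappa$ the set $P^{\mathcal M}$ is infinite and every permutation of it extends to an automorphism of $\mathcal M$; (c) there is a maximal model $\mathcal N$ of $\varphi_\kappa$ with $|\mathcal N|=|P^{\mathcal N}|=\kappa$. Here $\prec$ denotes elementary substructure in the fragment of $L_{\omega_1,\omega}$ generated by $\varphi_\kappa$ (the least set of formulas that contains $\varphi_\kappa$ and the atomic formulas and is closed under first-order operations, subformulas and substitution of terms), and a model of $\varphi_\kappa$ is maximal if it has no proper $\prec$-extension that is a model of $\varphi_\kappa$. Let $\varphi^*_\kappa$ be the $L_{\omega_1,\omega}$-sentence, in the vocabulary with unary $K,V,F$, binary $H,R,M$, ternary $E$ and a symbol $S(u,x_1,\dots,x_k)$ for each $k$-ary symbol $S$ of $L$, whose models are described as follows. * $K,V,F$ are pairwise disjoint, $M(u,x)$ implies $V(u)$, $\neg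 K(x)$ and $\neg F(x)$, and the universe is $K\cup V\cup F\cup\bigcup_{u\in V}M(u,\cdot)$. * $(V,R)$, with $R(u,v)$ meaning "$v$ is an immediate successor of $u$", is a tree with exactly one root in which every node has finite level. * $K$ is a copy of $\omega$, and $H(k,v)$ holds exactly when $k\in K$ and $v\in V$ has level $k$. * The elements $f\in F$ are pairwise distinct infinite branches of the tree, $E(k,f,v)$ holds exactly when $v$ is the node of $f$ at level $k$, and infinitely many elements of $F$ pass through each node. * The sets $M(u,\cdot)$, $u\in V$, are pairwise disjoint. For each $u\in V$ the set $M(u,\cdot)$ with the symbols $S(u,\cdot)$ is a model of $\varphi_\kappa$ in which the predicate $P(u,\cdot)$ is the set $R(u,\cdot)=M(u,\cdot)\cap V$ of immediate successors of $u$. Relations $S(u,\cdot)$ are false, and functions $S(u,\cdot)$ take the value $u$, whenever $u\notin V$ or some argument $x_i$ is not in $M(u,\cdot)$. Let $\mathbf K$ be the class of models of $\varphi^*_\kappa$. For $\mathcal N_0,\mathcal N_1\in\mathbf K$ let $\mathcal N_0\prec_{\mathbf K}\mathcal N_1$ mean that $\mathcal N_0$ is a substructure of $\mathcal N_1$ and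 $M(u,\cdot)^{\mathcal N_0}\prec M(u,\cdot)^{\mathcal N_1}$ for every $u\in V^{\mathcal N_0}$. A class of structures with a strong substructure relation satisfies $\mathrm{JEP}(<\kappa)$ if any two of its members of size less than $\kappa$ embed into a common member of the class by embeddings whose images are strong substructures. Theorem. If the models of $\varphi_\kappa$, with $\prec$, satisfy $\mathrm{JEP}(<\kappa)$, then $(\mathbf K,\prec_{\mathbf K})$ satisfies $\mathrm{JEP}(<\kappa)$. -/

import Mathlib

open FirstOrder FirstOrder.Language Cardinal

universe u v w

/-! ## The logic `L_{ω₁,ω}` -/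

/-- Formulas of `L_{ω₁,ω}` over the vocabulary `L` whose free variables are among `x₀, …, x_{n-1}`.
In `all ψ` the quantified variable is the last one, `xₙ`, of `ψ`; `conj` is the conjunction of a
sequence of formulas. The remaining connectives are abbreviations, given below. -/
inductive InfFormula (L : FirstOrder.Language.{v, w}) : ℕ → Type (max v w)
  | falsum {n : ℕ} : InfFormula L n
  | equal {n : ℕ} (t s : L.Term (Fin n)) : InfFormula L n
  | rel {n k : ℕ} (R : L.Relations k) (ts : Fin k → L.Term (Fin n)) : InfFormula L n
  | imp {n : ℕ} (a b : InfFormula L n) : InfFormula L n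
  | all {n : ℕ} (a : InfFormula L (n + 1)) : InfFormula L n
  | conj {n : ℕ} (a : ℕ → InfFormula L n) : InfFormula L n

namespace InfFormula

variable {L : FirstOrder.Language.{v, w}}

/-- Satisfaction of a formula in the structure `M` under an assignment. -/
def Realize {M : Type u} [L.Structure M] : {n : ℕ} → InfFormula L n → (Fin n → M) → Prop
  | _, falsum, _ => False
  | _, equal t s, x => t.realize x = s.realize x
  | _, rel R ts, x => Structure.RelMap R fun i => (ts i).realize x
  | _, imp a b, x => a.Realize x → b.Realize x
  | _, all a, x => ∀ y : M, a.Realize (Fin.snoc x y)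
  | _, conj a, x => ∀ k, (a k).Realize x

/-- The structure `M` is a model of the sentence `φ`. -/
def Models (M : Type u) [L.Structure M] (φ : InfFormula L 0) : Prop :=
  φ.Realize (default : Fin 0 → M)

/-- Negation. -/
def not {n : ℕ} (a : InfFormula L n) : InfFormula L n := imp a falsum

/-- Truth. -/
def verum {n : ℕ} : InfFormula L n := not falsum

/-- Binary conjunction. -/
def and {n : ℕ} (a b : InfFormula L n) : InfFormula L n := not (imp a (not b))

/-- Binary disjunction. -/
def or {n : ℕ} (a b : InfFormula L n) : InfFormula L n := imp (not a) b

/-- Equivalence. -/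
def iff {n : ℕ} (a b : InfFormula L n) : InfFormula L n := and (imp a b) (imp b a)

/-- Existential quantification over the last variable. -/
def ex {n : ℕ} (a : InfFormula L (n + 1)) : InfFormula L n := not (all (not a))

/-- Disjunction of a sequence of formulas. -/
def disj {n : ℕ} (a : ℕ → InfFormula L n) : InfFormula L n := not (conj fun k => not (a k))

/-- Conjunction of a family of formulas indexed by a countable type. -/
noncomputable def iConj {ι : Type*} [Countable ι] {n : ℕ} (a : ι → InfFormula L n) :
    InfFormula L n :=
  letI := Encodable.ofCountable ι
  conj fun k => (Encodable.decode (α := ι) k).elim verum a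

/-- Conjunction of a finite list of formulas. -/
def listConj {n : ℕ} : List (InfFormula L n) → InfFormula L n
  | [] => verum
  | a :: l => and a (listConj l)

/-- Universal closure of a formula. -/
def alls : {n : ℕ} → InfFormula L n → InfFormula L 0
  | 0, a => a
  | _ + 1, a => alls (all a)

/-- Universal quantification over the last `k` variables. -/
def allN {n : ℕ} : (k : ℕ) → InfFormula L (n + k) → InfFormula L n
  | 0, a => a
  | k + 1, a => allN k (all a)

/-- Substitution of terms for the free variables. -/
def subst : {n : ℕ} → InfFormula L n → {m : ℕ} → (Fin n → L.Term (Fin m)) → InfFormula L m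
  | _, falsum, _, _ => falsum
  | _, equal t s, _, σ => equal (t.subst σ) (s.subst σ)
  | _, rel R ts, _, σ => rel R fun i => (ts i).subst σ
  | _, imp a b, _, σ => imp (a.subst σ) (b.subst σ)
  | _, all a, m, σ =>
      all (a.subst (Fin.snoc (fun i => (σ i).relabel Fin.castSucc) (Term.var (Fin.last m))))
  | _, conj a, _, σ => conj fun k => (a k).subst σ

/-- The fragment generated by the sentence `φ`: the smallest set of formulas that contains `φ` and
the atomic formulas and is closed under the first-order operations, under subformulas and under
substitution of terms. -/
inductive Fragment (φ : InfFormula L 0) : {n : ℕ} → InfFormula L n → Prop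
  | self : Fragment φ φ
  | falsum {n : ℕ} : Fragment φ (falsum : InfFormula L n)
  | equal {n : ℕ} (t s : L.Term (Fin n)) : Fragment φ (equal t s)
  | rel {n k : ℕ} (R : L.Relations k) (ts : Fin k → L.Term (Fin n)) : Fragment φ (rel R ts)
  | imp {n : ℕ} {a b : InfFormula L n} : Fragment φ a → Fragment φ b → Fragment φ (imp a b)
  | all {n : ℕ} {a : InfFormula L (n + 1)} : Fragment φ a → Fragment φ (all a)
  | of_imp_left {n : ℕ} {a b : InfFormula L n} : Fragment φ (imp a b) → Fragment φ a
  | of_imp_right {n : ℕ} {a b : InfFormula L n} : Fragment φ (imp a b) → Fragment φ b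
  | of_all {n : ℕ} {a : InfFormula L (n + 1)} : Fragment φ (all a) → Fragment φ a
  | of_conj {n : ℕ} {a : ℕ → InfFormula L n} (k : ℕ) : Fragment φ (conj a) → Fragment φ (a k)
  | subst {n m : ℕ} {a : InfFormula L n} (σ : Fin n → L.Term (Fin m)) :
      Fragment φ a → Fragment φ (a.subst σ)

/-- The map `f` preserves and reflects all formulas of the fragment generated by `φ`. When `f` is the
inclusion of a substructure, this says that `M` is an elementary substructure of `N` in that
fragment. -/
def IsElementary (φ : InfFormula L 0) {M N : Type u} [L.Structure M] [L.Structure N]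
    (f : M → N) : Prop :=
  ∀ {n : ℕ} (a : InfFormula L n), Fragment φ a → ∀ x : Fin n → M,
    (a.Realize (fun i => f (x i)) ↔ a.Realize x)

/-- `φ` is a complete sentence: it has a model and decides every `L_{ω₁,ω}`-sentence. -/
def IsComplete (φ : InfFormula L 0) : Prop :=
  (∃ (M : Type u) (_ : L.Structure M), φ.Models M) ∧
  ∀ a : InfFormula L 0,
    (∀ (M : Type u) [L.Structure M], φ.Models M → a.Models M) ∨
    (∀ (M : Type u) [L.Structure M], φ.Models M → a.not.Models M)

end InfFormula

/-! ## Homogeneous characterization of cardinals -/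

section Characterization

variable {L : FirstOrder.Language.{v, w}}

/-- The interpretation of a unary predicate. -/
def predSet (P : L.Relations 1) (M : Type u) [L.Structure M] : Set M :=
  {x | Structure.RelMap P ![x]}

/-- The interpretation of `P` in `M` is a set of absolute indiscernibles for `M`. -/
def AbsolutelyIndiscernible (P : L.Relations 1) (M : Type u) [L.Structure M] : Prop :=
  (predSet P M).Infinite ∧
  ∀ σ : Equiv.Perm (predSet P M), ∃ g : M ≃[L] M, ∀ x : predSet P M, g x = σ x

/-- `M` is a maximal model of `φ`: a model without proper elementary extensions (in the fragment
generated by `φ`) among the models of `φ`. -/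
def IsMaximalModel (φ : InfFormula L 0) (M : Type u) [L.Structure M] : Prop :=
  φ.Models M ∧
  ∀ (N : Type u) [L.Structure N], φ.Models N → ∀ f : M ↪[L] N, φ.IsElementary f →
    Function.Surjective f

/-- The complete sentence `φ` homogeneously characterizes the infinite cardinal `κ`, with absolute
indiscernibles in `P`. -/
structure HomogeneouslyCharacterizes (φ : InfFormula L 0) (P : L.Relations 1)
    (κ : Cardinal.{u}) : Prop where
  infinite : ℵ₀ ≤ κ
  complete : InfFormula.IsComplete.{u} φ
  no_larger : ∀ (M : Type u) [L.Structure M], φ.Models M → #M ≠ Order.succ κ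
  indiscernible : ∃ (M : Type u) (_ : L.Structure M),
    Countable M ∧ φ.Models M ∧ AbsolutelyIndiscernible P M
  maximal : ∃ (M : Type u) (_ : L.Structure M),
    IsMaximalModel φ M ∧ #M = κ ∧ #(predSet P M) = κ

end Characterization

/-! ## Joint embedding -/

/-- A class of `L`-structures with a notion of strong embedding between its members. -/
structure StrongClass (L : FirstOrder.Language.{v, w}) where
  Mem : ∀ (M : Type u) [L.Structure M], Prop
  Strong : ∀ {M N : Type u} [L.Structure M] [L.Structure N], Mem M → Mem N → (M ↪[L] N) → Prop

/-- `JEP(<κ)`: any two members of size `< κ` have strong embeddings into a common member. -/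
def StrongClass.JEPBelow {L : FirstOrder.Language.{v, w}} (C : StrongClass.{u} L) (κ : Cardinal.{u}) : Prop :=
  ∀ (M₀ M₁ : Type u) [L.Structure M₀] [L.Structure M₁] (h₀ : C.Mem M₀) (h₁ : C.Mem M₁),
    #M₀ < κ → #M₁ < κ →
    ∃ (N : Type u) (_ : L.Structure N) (h : C.Mem N) (f₀ : M₀ ↪[L] N) (f₁ : M₁ ↪[L] N),
      C.Strong h₀ h f₀ ∧ C.Strong h₁ h f₁

/-- The models of the sentence `φ`, with the embeddings that are elementary in the fragment
generated by `φ`. -/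
def modelClass {L : FirstOrder.Language.{v, w}} (φ : InfFormula L 0) : StrongClass.{u} L where
  Mem M _ := φ.Models M
  Strong _ _ f := φ.IsElementary f

/-! ## The vocabulary of trees of models -/

section Star

/-- The function symbols: each `k`-ary `f` of `L` gives a function symbol `f(u, x₁, …, x_k)`. -/
inductive StarFunctions (L : FirstOrder.Language.{v, w}) : ℕ → Type v
  | lift {k : ℕ} (f : L.Functions k) : StarFunctions L (k + 1)

/-- The relation symbols: the sorts `K` (levels), `V` (nodes) and `F` (branches); `H(k, v)`, the node
`v` has level `k`; `R(u, v)`, the node `v` is an immediate successor of `u`; `E(k, f, v)`, the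
restriction of the branch `f` to level `k` is `v`; `M(u, x)`, the element `x` belongs to the model
attached to the node `u`; and `S(u, x₁, …, x_k)` for each `k`-ary `S` of `L`. -/
inductive StarRelations (L : FirstOrder.Language.{v, w}) : ℕ → Type w
  | K : StarRelations L 1
  | V : StarRelations L 1
  | F : StarRelations L 1
  | H : StarRelations L 2
  | R : StarRelations L 2
  | E : StarRelations L 3
  | M : StarRelations L 2
  | lift {k : ℕ} (S : L.Relations k) : StarRelations L (k + 1)

/-- The vocabulary of trees of `L`-structures. -/
def starLang (L : FirstOrder.Language.{v, w}) : FirstOrder.Language.{v, w} where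
  Functions := StarFunctions L
  Relations := StarRelations L

variable {L : FirstOrder.Language.{v, w}} {n : ℕ}

namespace Star

open InfFormula

/-- Equality of variables. -/
def eq (i j : Fin n) : InfFormula (starLang L) n := equal (Term.var i) (Term.var j)

/-- `K(xᵢ)`. -/
def K (i : Fin n) : InfFormula (starLang L) n :=
  rel (k := 1) StarRelations.K ![Term.var i]

/-- `V(xᵢ)`. -/
def V (i : Fin n) : InfFormula (starLang L) n :=
  rel (k := 1) StarRelations.V ![Term.var i]

/-- `F(xᵢ)`. -/
def F (i : Fin n) : InfFormula (starLang L) n :=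
  rel (k := 1) StarRelations.F ![Term.var i]

/-- `H(xᵢ, xⱼ)`. -/
def H (i j : Fin n) : InfFormula (starLang L) n :=
  rel (k := 2) StarRelations.H ![Term.var i, Term.var j]

/-- `R(xᵢ, xⱼ)`. -/
def R (i j : Fin n) : InfFormula (starLang L) n :=
  rel (k := 2) StarRelations.R ![Term.var i, Term.var j]

/-- `E(xᵢ, xⱼ, xₗ)`. -/
def E (i j l : Fin n) : InfFormula (starLang L) n :=
  rel (k := 3) StarRelations.E ![Term.var i, Term.var j, Term.var l]

/-- `M(xᵢ, xⱼ)`. -/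
def M (i j : Fin n) : InfFormula (starLang L) n :=
  rel (k := 2) StarRelations.M ![Term.var i, Term.var j]

/-- `P(xᵢ, xⱼ)` for a unary predicate `P` of `L`. -/
def P (p : L.Relations 1) (i j : Fin n) : InfFormula (starLang L) n :=
  rel (k := 2) (StarRelations.lift p) ![Term.var i, Term.var j]

/-- The node `xᵢ` is at distance `m` from a root. -/
def level : ℕ → {n : ℕ} → Fin n → InfFormula (starLang L) n
  | 0, n, i => and (V i) (not (ex (R (Fin.last n) i.castSucc)))
  | m + 1, n, i => ex (and (R (Fin.last n) i.castSucc) (level m (Fin.last n)))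

/-- The element `xᵢ` of `K` is the natural number `m`: it is related by `H` exactly to the nodes of
level `m`. -/
def isNum (m : ℕ) (i : Fin n) : InfFormula (starLang L) n :=
  and (K i) (all (iff (H i.castSucc (Fin.last n)) (level m (Fin.last n))))

/-- `x₀` is a node and `x₁, …, x_k` belong to the model attached to it. -/
noncomputable def inNode (k : ℕ) : InfFormula (starLang L) (k + 1) :=
  and (V 0) (iConj fun i : Fin k => M 0 i.succ)

/-! ### Relativization to the model attached to the node `x₀` -/

/-- The term `t(x₁, …, x_n)` evaluated in the model attached to `x₀`. -/
def relTerm : L.Term (Fin n) → (starLang L).Term (Fin (n + 1))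
  | .var i => .var i.succ
  | .func f ts => .func (StarFunctions.lift f) (Fin.cons (.var 0) fun i => relTerm (ts i))

/-- The formula `a(x₁, …, x_n)`, evaluated in the model attached to `x₀`. -/
def relativize : {n : ℕ} → InfFormula L n → InfFormula (starLang L) (n + 1)
  | _, .falsum => falsum
  | _, .equal t s => equal (relTerm t) (relTerm s)
  | _, .rel S ts => rel (StarRelations.lift S) (Fin.cons (.var 0) fun i => relTerm (ts i))
  | _, .imp a b => imp (relativize a) (relativize b)
  | n, .all a => all (imp (M 0 (Fin.last (n + 1))) (relativize a))
  | _, .conj a => conj fun k => relativize (a k)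

/-! ### The axioms

Inside a block of quantifiers, the variables are numbered from the outside, starting with 0. -/

/-- The sorts `K`, `V`, `F` are disjoint and, together with the attached models, cover the universe;
the arguments of the symbols have the right sorts. -/
def sortAxioms : List (InfFormula (starLang L) 0) :=
  [ all (not (and (K 0) (V 0))),
    all (not (and (K 0) (F 0))),
    all (not (and (V 0) (F 0))),
    all (or (K 0) (or (V 0) (or (F 0) (ex (M 1 0))))),
    all (all (imp (H 0 1) (and (K 0) (V 1)))),
    all (all (imp (R 0 1) (and (V 0) (V 1)))),
    all (all (all (imp (E 0 1 2) (and (K 0) (and (F 1) (V 2)))))),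
    all (all (imp (M 0 1) (and (V 0) (and (not (K 1)) (not (F 1)))))) ]

/-- `(V, R)` is a tree of height at most `ω` with one root, and `K` with `H` is the standard `ω`,
each `m` being matched with level `m` of the tree. -/
def treeAxioms : List (InfFormula (starLang L) 0) :=
  [ ex (and (level 0 0) (all (imp (level 0 1) (eq 1 0)))),
    all (all (all (imp (and (R 0 2) (R 1 2)) (eq 0 1)))),
    all (imp (V 0) (disj fun m => level m 0)),
    conj fun m => ex (and (isNum m 0) (all (imp (isNum m 1) (eq 1 0)))),
    all (imp (K 0) (disj fun m => isNum m 0)) ]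

/-- The elements of `F` are, through `E`, pairwise different branches of the tree, and infinitely
many of them pass through each node. -/
noncomputable def branchAxioms : List (InfFormula (starLang L) 0) :=
  [ all (all (imp (and (K 0) (F 1)) (ex (and (E 0 1 2) (all (imp (E 0 1 3) (eq 3 2))))))),
    all (all (all (imp (E 0 1 2) (H 0 2)))),
    -- if `f` restricted to `k` is `v` and `f` restricted to `l = k + 1` is `w`, then `R(v, w)`;
    -- here `k, f, v, l, w` are the variables 0, 1, 2, 3, 4, and 5 shows that `l = k + 1`
    all (all (all (all (all (all
      (imp (and (and (E 0 1 2) (E 3 1 4)) (and (R 2 5) (H 3 5))) (R 2 4))))))),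
    all (all (imp (and (and (F 0) (F 1)) (not (eq 0 1)))
      (ex (ex (and (E 2 0 3) (not (E 2 1 3))))))),
    -- for any `g₁, …, g_m` some branch through `x₀` differs from all of them
    all (imp (V 0) (conj fun m => allN m (ex
      (and (and (F (Fin.last (1 + m))) (ex (E (Fin.last (1 + m + 1)) (Fin.last (1 + m)).castSucc 0)))
        (iConj fun i : Fin m => not (eq (Fin.last (1 + m)) (i.natAdd 1).castSucc)))))) ]

/-- The models attached to the nodes: they are pairwise disjoint, the set of immediate successors of
`u` is the set of nodes in the model attached to `u` and also its predicate `p`, each `S(u, ·)` is a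
relation on this model, each `f(u, ·)` is an operation on it (with the value `u` outside of it), and
it satisfies `φ`. -/
noncomputable def modelAxioms [Countable (Σ k, L.Functions k)] [Countable (Σ k, L.Relations k)]
    (φ : InfFormula L 0) (p : L.Relations 1) : List (InfFormula (starLang L) 0) :=
  [ all (all (all (imp (and (M 0 2) (M 1 2)) (eq 0 1)))),
    all (all (iff (R 0 1) (and (M 0 1) (V 1)))),
    all (all (iff (R 0 1) (P p 0 1))),
    iConj fun S : Σ k, L.Relations k =>
      alls (imp (rel (StarRelations.lift S.2) Term.var) (inNode S.1)),
    iConj fun f : Σ k, L.Functions k =>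
      alls (imp (inNode f.1)
        (rel (k := 2) StarRelations.M ![Term.var 0, Term.func (StarFunctions.lift f.2) Term.var])),
    iConj fun f : Σ k, L.Functions k =>
      alls (imp (not (inNode f.1))
        (equal (Term.func (StarFunctions.lift f.2) Term.var) (Term.var 0))),
    all (imp (V 0) (relativize φ)) ]

end Star

open Star InfFormula

/-- The sentence `φ*`. Its models are the trees of height `ω`, with a set of branches, in which each
node `u` carries a model of `φ` whose predicate `p` is the set of immediate successors of `u`. -/
noncomputable def starSentence [Countable (Σ k, L.Functions k)] [Countable (Σ k, L.Relations k)]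
    (φ : InfFormula L 0) (p : L.Relations 1) : InfFormula (starLang L) 0 :=
  listConj (sortAxioms ++ treeAxioms ++ branchAxioms ++ modelAxioms φ p)

/-! ## The model attached to a node, and the strong embeddings -/

/-- `V(u)` in the structure `N`. -/
def IsNode (L : FirstOrder.Language.{v, w}) {N : Type u} [(starLang L).Structure N] (u : N) : Prop :=
  Structure.RelMap (L := starLang L) (n := 1) StarRelations.V ![u]

/-- `M(u, x)` in the structure `N`. -/
def InModel (L : FirstOrder.Language.{v, w}) {N : Type u} [(starLang L).Structure N] (u x : N) : Prop :=
  Structure.RelMap (L := starLang L) (n := 2) StarRelations.M ![u, x]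

/-! The helper facts here show that the attached model is closed under the functions. -/

theorem realize_and {L : FirstOrder.Language.{v, w}} {N : Type u} [L.Structure N] {n : ℕ}
    {a b : InfFormula L n} {x : Fin n → N} :
    (and a b).Realize x ↔ a.Realize x ∧ b.Realize x := by
  simp only [InfFormula.and, InfFormula.not, Realize]; tauto

theorem realize_iConj {L : FirstOrder.Language.{v, w}} {N : Type u} [L.Structure N] {n : ℕ} {ι : Type*}
    [Countable ι] {a : ι → InfFormula L n} {x : Fin n → N} :
    (iConj a).Realize x ↔ ∀ i, (a i).Realize x := by
  let _ := Encodable.ofCountable ι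
  constructor
  · intro h i
    have := h (Encodable.encode i)
    simpa [Encodable.encodek] using this
  · intro h k
    rcases hk : (Encodable.decode (α := ι) k) with _ | i
    · simp [hk, verum, InfFormula.not, Realize]
    · simpa [hk] using h i

theorem realize_listConj {L : FirstOrder.Language.{v, w}} {N : Type u} [L.Structure N] {n : ℕ}
    {l : List (InfFormula L n)} {x : Fin n → N} :
    (listConj l).Realize x ↔ ∀ a ∈ l, a.Realize x := by
  induction l with
  | nil => simp [listConj, verum, InfFormula.not, Realize]
  | cons a l ih => simp [listConj, realize_and, ih]

theorem models_alls {L : FirstOrder.Language.{v, w}} {N : Type u} [L.Structure N] {n : ℕ}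
    {a : InfFormula L n} : (alls a).Models N ↔ ∀ x : Fin n → N, a.Realize x := by
  induction n with
  | zero =>
    exact ⟨fun h x => by rwa [Subsingleton.elim x default], fun h => h _⟩
  | succ n ih =>
    refine ih.trans ⟨fun h x => ?_, fun h x y => h _⟩
    simpa using h (Fin.init x) (x (Fin.last n))

theorem IsNode.map {N₀ N₁ : Type u} [(starLang L).Structure N₀] [(starLang L).Structure N₁]
    (f : N₀ ↪[starLang L] N₁) {u : N₀} (hu : IsNode L u) : IsNode L (f u) := by
  have h := (f.map_rel (n := 1) StarRelations.V ![u]).2 hu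
  unfold IsNode
  convert h using 1
  funext i
  fin_cases i; rfl

theorem InModel.map {N₀ N₁ : Type u} [(starLang L).Structure N₀] [(starLang L).Structure N₁]
    (f : N₀ ↪[starLang L] N₁) {u x : N₀} (hx : InModel L u x) : InModel L (f u) (f x) := by
  have h := (f.map_rel (n := 2) StarRelations.M ![u, x]).2 hx
  unfold InModel
  convert h using 1
  funext i
  fin_cases i <;> rfl

variable [Countable (Σ k, L.Functions k)] [Countable (Σ k, L.Relations k)]
  {φ : InfFormula L 0} {p : L.Relations 1}

theorem inModel_funMap {N : Type u} [(starLang L).Structure N]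
    (hN : (starSentence φ p).Models N) {u : N} (hu : IsNode L u) {k : ℕ} (f : L.Functions k)
    (x : Fin k → N) (hx : ∀ i, InModel L u (x i)) :
    InModel L u (Structure.funMap (L := starLang L) (n := k + 1) (StarFunctions.lift f)
      (Fin.cons u x)) := by
  have h := realize_listConj.1 hN (iConj fun f : Σ k, L.Functions k =>
      alls (imp (inNode f.1)
        (rel (k := 2) StarRelations.M ![Term.var 0, Term.func (StarFunctions.lift f.2) Term.var])))
      (by simp [modelAxioms])
  have h' := models_alls.1 (realize_iConj.1 h ⟨k, f⟩) (Fin.cons u x)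
  have h2 := h' (realize_and.2 ⟨?_, realize_iConj.2 fun i => ?_⟩)
  · unfold InModel
    simp only [Realize] at h2
    convert h2 using 1
    funext i
    fin_cases i <;> rfl
  · unfold IsNode at hu
    simp only [V, Realize]
    convert hu using 1
    funext i
    fin_cases i; rfl
  · have := hx i
    unfold InModel at this
    simp only [M, Realize]
    convert this using 1
    funext i
    fin_cases i <;> rfl

/-- The model attached to the node `u` of a model `N` of `φ*`: its universe is `M(u, ·)`, which
contains `R(u, ·)`. -/
def NodeModel {N : Type u} [(starLang L).Structure N] (_hN : (starSentence φ p).Models N) (u : N)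
    (_hu : IsNode L u) : Type u :=
  {x : N // InModel L u x}

/-- The model attached to `u` is an `L`-structure through the relations `S(u, ·)` and the functions
`f(u, ·)`. -/
instance {N : Type u} [(starLang L).Structure N] (hN : (starSentence φ p).Models N) (u : N)
    (hu : IsNode L u) : L.Structure (NodeModel hN u hu) where
  funMap {k} f x :=
    ⟨Structure.funMap (L := starLang L) (n := k + 1) (StarFunctions.lift f)
      (Fin.cons u fun i => (x i).1), inModel_funMap hN hu f _ fun i => (x i).2⟩
  RelMap {k} S x :=
    Structure.RelMap (L := starLang L) (n := k + 1) (StarRelations.lift S)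
      (Fin.cons u fun i => (x i).1)

/-- The map that an embedding of models of `φ*` induces between the models attached to `u` and to
the image of `u`. -/
def NodeModel.map {N₀ N₁ : Type u} [(starLang L).Structure N₀] [(starLang L).Structure N₁]
    (h₀ : (starSentence φ p).Models N₀) (h₁ : (starSentence φ p).Models N₁)
    (f : N₀ ↪[starLang L] N₁) (u : N₀) (hu : IsNode L u) :
    NodeModel h₀ u hu → NodeModel h₁ (f u) (hu.map f) :=
  fun x => ⟨f x.1, x.2.map f⟩

/-- The class of models of `φ*`. An embedding `f : N₀ → N₁` is strong if, for each node `u` of `N₀`,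
it is elementary in the fragment generated by `φ` from the model attached to `u` to the one attached
to `f u`. For the inclusion of a substructure this is the relation `N₀ ≺ N₁` of the class. -/
def starClass (φ : InfFormula L 0) (p : L.Relations 1) : StrongClass.{u} (starLang L) where
  Mem N _ := (starSentence φ p).Models N
  Strong h₀ h₁ f := ∀ u (hu : IsNode L u), φ.IsElementary (NodeModel.map h₀ h₁ f u hu)

end Star

/-! ## Semantics of the sentence `φ*` -/

namespace InfFormula

variable {L : FirstOrder.Language.{v, w}} {N : Type u} [L.Structure N] {n : ℕ}

/-! The common extension is a tree of models grown from pairs of nodes. A state is a pair `(u₀, u₁)`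
with `u₀` a node of `M₀` and `u₁` a node of `M₁`. The models attached to `u₀` and `u₁` have size
below `κ`, so `JEP(<κ)` for `φ` embeds both elementarily into one model `A` of `φ`; this `A` is
attached to every tree node in state `(u₀, u₁)`. Each element of `P` in `A` becomes an immediate
successor. Its state is found by decoding it in each coordinate separately: if it is the image of a
node `v`, the coordinate becomes `v`; otherwise any value will do. Growth starts from the pair of
roots, and `F` consists of all infinite branches.

The result is a model of `φ*` (`TreeData.isStarModel`). Its levels are nonempty and infinitely many
branches pass through each node because `P` is infinite in every model of `φ`: this holds in the
countable model, is expressible in `L_{ω₁,ω}`, and `φ` is complete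
(`HomogeneouslyCharacterizes.predSet_infinite`).

To embed `Mᵢ`, send a node to the path that follows the images of its ancestors and of itself. Along
this path coordinate `i` of the state is the node being coded, whatever the other coordinate does.
Elements of attached models follow the elementary embeddings, and a branch goes to the branch
through the codes of its nodes, which is available because all branches were put in. Each embedding
thus sees only one coordinate. This is abstracted as `Labelling`, and `Labelling.exists_strong` is
applied once per coordinate. Overlaps between the two images do no harm, since only a common target
is required. -/

@[simp] theorem realize_equal' {t s : L.Term (Fin n)} {x : Fin n → N} :
    (equal t s).Realize x ↔ t.realize x = s.realize x := Iff.rfl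

@[simp] theorem realize_imp' {a b : InfFormula L n} {x : Fin n → N} :
    (imp a b).Realize x ↔ (a.Realize x → b.Realize x) := Iff.rfl

@[simp] theorem realize_all' {a : InfFormula L (n + 1)} {x : Fin n → N} :
    (all a).Realize x ↔ ∀ y : N, a.Realize (Fin.snoc x y) := Iff.rfl

@[simp] theorem realize_conj' {a : ℕ → InfFormula L n} {x : Fin n → N} :
    (conj a).Realize x ↔ ∀ k, (a k).Realize x := Iff.rfl

@[simp] theorem realize_not {a : InfFormula L n} {x : Fin n → N} :
    (not a).Realize x ↔ ¬ a.Realize x := Iff.rfl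

@[simp] theorem realize_and' {a b : InfFormula L n} {x : Fin n → N} :
    (and a b).Realize x ↔ a.Realize x ∧ b.Realize x := realize_and

@[simp] theorem realize_or {a b : InfFormula L n} {x : Fin n → N} :
    (or a b).Realize x ↔ a.Realize x ∨ b.Realize x := by
  simp only [or, realize_imp', realize_not]; tauto

@[simp] theorem realize_iff {a b : InfFormula L n} {x : Fin n → N} :
    (iff a b).Realize x ↔ (a.Realize x ↔ b.Realize x) := by
  simp only [iff, realize_and', realize_imp']; tauto

@[simp] theorem realize_ex {a : InfFormula L (n + 1)} {x : Fin n → N} :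
    (ex a).Realize x ↔ ∃ y : N, a.Realize (Fin.snoc x y) := by
  simp [ex]

@[simp] theorem realize_disj {a : ℕ → InfFormula L n} {x : Fin n → N} :
    (disj a).Realize x ↔ ∃ k, (a k).Realize x := by
  simp [disj]

@[simp] theorem realize_iConj' {ι : Type*} [Countable ι] {a : ι → InfFormula L n} {x : Fin n → N} :
    (iConj a).Realize x ↔ ∀ i, (a i).Realize x := realize_iConj

theorem realize_allN {k : ℕ} {a : InfFormula L (n + k)} {x : Fin n → N} :
    (allN k a).Realize x ↔ ∀ y : Fin k → N, a.Realize (Fin.append x y) := by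
  induction k with
  | zero =>
    refine ⟨fun h y => ?_, fun h => ?_⟩
    · have : Fin.append x y = x := by
        rw [Subsingleton.elim y Fin.elim0, Fin.append_elim0]; rfl
      rw [this]; exact h
    · have := h Fin.elim0
      rwa [Fin.append_elim0] at this
  | succ k ih =>
    refine (ih (a := all a)).trans ⟨fun h y => ?_, fun h y z => ?_⟩
    · have := h (Fin.init y) (y (Fin.last k))
      rwa [← Fin.append_snoc, Fin.snoc_init_self] at this
    · have := h (Fin.snoc y z)
      rwa [Fin.append_snoc] at this

end InfFormula

/-! ### The axioms of `φ*` in semantic form. -/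

namespace Star

open InfFormula

variable {L : FirstOrder.Language.{v, w}} {N : Type u} [(starLang L).Structure N] {n : ℕ}

/-- `K(x)` in the structure `N`. -/
def IsK (L : FirstOrder.Language.{v, w}) {N : Type u} [(starLang L).Structure N] (x : N) : Prop :=
  Structure.RelMap (L := starLang L) (n := 1) StarRelations.K ![x]

/-- `F(x)` in the structure `N`. -/
def IsF (L : FirstOrder.Language.{v, w}) {N : Type u} [(starLang L).Structure N] (x : N) : Prop :=
  Structure.RelMap (L := starLang L) (n := 1) StarRelations.F ![x]

/-- `H(k, x)` in the structure `N`. -/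
def HRel (L : FirstOrder.Language.{v, w}) {N : Type u} [(starLang L).Structure N] (k x : N) : Prop :=
  Structure.RelMap (L := starLang L) (n := 2) StarRelations.H ![k, x]

/-- `R(x, y)` in the structure `N`. -/
def RRel (L : FirstOrder.Language.{v, w}) {N : Type u} [(starLang L).Structure N] (x y : N) : Prop :=
  Structure.RelMap (L := starLang L) (n := 2) StarRelations.R ![x, y]

/-- `E(k, f, x)` in the structure `N`. -/
def ERel (L : FirstOrder.Language.{v, w}) {N : Type u} [(starLang L).Structure N] (k f x : N) :
    Prop :=
  Structure.RelMap (L := starLang L) (n := 3) StarRelations.E ![k, f, x]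

/-- The element `x` is a node at distance `m` from a root. -/
def HasLevel (L : FirstOrder.Language.{v, w}) {N : Type u} [(starLang L).Structure N] : ℕ → N → Prop
  | 0, x => IsNode L x ∧ ¬ ∃ y, RRel L y x
  | m + 1, x => ∃ y, RRel L y x ∧ HasLevel L m y

/-- The element `x` of `K` is the number `m`. -/
def HasNum (L : FirstOrder.Language.{v, w}) {N : Type u} [(starLang L).Structure N] (m : ℕ) (x : N) :
    Prop :=
  IsK L x ∧ ∀ y, HRel L x y ↔ HasLevel L m y

theorem term_vec1 (x : Fin n → N) (i : Fin n) :
    (fun j => ((![Term.var i] : Fin 1 → (starLang L).Term (Fin n)) j).realize x) = ![x i] := by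
  funext j; fin_cases j; rfl

theorem term_vec2 (x : Fin n → N) (i j : Fin n) :
    (fun l => ((![Term.var i, Term.var j] : Fin 2 → (starLang L).Term (Fin n)) l).realize x) =
      ![x i, x j] := by
  funext j; fin_cases j <;> rfl

theorem term_vec3 (x : Fin n → N) (i j k : Fin n) :
    (fun l => ((![Term.var i, Term.var j, Term.var k] :
      Fin 3 → (starLang L).Term (Fin n)) l).realize x) = ![x i, x j, x k] := by
  funext j; fin_cases j <;> rfl

@[simp] theorem realize_eq {i j : Fin n} {x : Fin n → N} :
    (eq (L := L) i j).Realize x ↔ x i = x j := Iff.rfl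

@[simp] theorem realize_K {i : Fin n} {x : Fin n → N} :
    (K (L := L) i).Realize x ↔ IsK L (x i) := by
  simp only [K, InfFormula.Realize, term_vec1]; rfl

@[simp] theorem realize_V {i : Fin n} {x : Fin n → N} :
    (V (L := L) i).Realize x ↔ IsNode L (x i) := by
  simp only [V, InfFormula.Realize, term_vec1]; rfl

@[simp] theorem realize_F {i : Fin n} {x : Fin n → N} :
    (F (L := L) i).Realize x ↔ IsF L (x i) := by
  simp only [F, InfFormula.Realize, term_vec1]; rfl

@[simp] theorem realize_H {i j : Fin n} {x : Fin n → N} :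
    (H (L := L) i j).Realize x ↔ HRel L (x i) (x j) := by
  simp only [H, InfFormula.Realize, term_vec2]; rfl

@[simp] theorem realize_R {i j : Fin n} {x : Fin n → N} :
    (R (L := L) i j).Realize x ↔ RRel L (x i) (x j) := by
  simp only [R, InfFormula.Realize, term_vec2]; rfl

@[simp] theorem realize_M {i j : Fin n} {x : Fin n → N} :
    (M (L := L) i j).Realize x ↔ InModel L (x i) (x j) := by
  simp only [M, InfFormula.Realize, term_vec2]; rfl

@[simp] theorem realize_E {i j k : Fin n} {x : Fin n → N} :
    (E (L := L) i j k).Realize x ↔ ERel L (x i) (x j) (x k) := by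
  simp only [E, InfFormula.Realize, term_vec3]; rfl

@[simp] theorem realize_P {p : L.Relations 1} {i j : Fin n} {x : Fin n → N} :
    (P p i j).Realize x ↔ Structure.RelMap (L := starLang L) (n := 2) (StarRelations.lift p)
      ![x i, x j] := by
  simp only [P, InfFormula.Realize, term_vec2]

@[simp] theorem realize_level {m : ℕ} {i : Fin n} {x : Fin n → N} :
    (level (L := L) m i).Realize x ↔ HasLevel L m (x i) := by
  induction m generalizing n with
  | zero => simp [level, HasLevel]
  | succ m ih => simp [level, HasLevel, ih]

@[simp] theorem realize_isNum {m : ℕ} {i : Fin n} {x : Fin n → N} :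
    (isNum (L := L) m i).Realize x ↔ HasNum L m (x i) := by
  simp [isNum, HasNum]

@[simp] theorem realize_inNode {k : ℕ} {x : Fin (k + 1) → N} :
    (inNode (L := L) k).Realize x ↔ IsNode L (x 0) ∧ ∀ i : Fin k, InModel L (x 0) (x i.succ) := by
  simp [inNode]

/-- The conjunction of the axioms of `φ*`, in semantic form. -/
structure IsStarModel (φ : InfFormula L 0) (p : L.Relations 1) (N : Type u)
    [(starLang L).Structure N] : Prop where
  not_K_V : ∀ x : N, IsK L x → ¬ IsNode L x
  not_K_F : ∀ x : N, IsK L x → ¬ IsF L x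
  not_V_F : ∀ x : N, IsNode L x → ¬ IsF L x
  cover : ∀ x : N, IsK L x ∨ IsNode L x ∨ IsF L x ∨ ∃ u, InModel L u x
  H_sort : ∀ k x : N, HRel L k x → IsK L k ∧ IsNode L x
  R_sort : ∀ x y : N, RRel L x y → IsNode L x ∧ IsNode L y
  E_sort : ∀ k f x : N, ERel L k f x → IsK L k ∧ IsF L f ∧ IsNode L x
  M_sort : ∀ u x : N, InModel L u x → IsNode L u ∧ ¬ IsK L x ∧ ¬ IsF L x
  root : ∃ r : N, HasLevel L 0 r ∧ ∀ x, HasLevel L 0 x → x = r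
  pred_unique : ∀ x y z : N, RRel L x z → RRel L y z → x = y
  exists_level : ∀ x : N, IsNode L x → ∃ m, HasLevel L m x
  exists_num : ∀ m, ∃ k : N, HasNum L m k ∧ ∀ l, HasNum L m l → l = k
  hasNum : ∀ k : N, IsK L k → ∃ m, HasNum L m k
  E_exists : ∀ k f : N, IsK L k → IsF L f → ∃ x, ERel L k f x ∧ ∀ y, ERel L k f y → y = x
  E_level : ∀ k f x : N, ERel L k f x → HRel L k x
  E_step : ∀ k f x l y z : N, ERel L k f x → ERel L l f y → RRel L x z → HRel L l z →
    RRel L x y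
  F_ext : ∀ f g : N, IsF L f → IsF L g → f ≠ g → ∃ k x, ERel L k f x ∧ ¬ ERel L k g x
  F_infinite : ∀ x : N, IsNode L x → ∀ m (g : Fin m → N),
    ∃ f, (IsF L f ∧ ∃ k, ERel L k f x) ∧ ∀ i, f ≠ g i
  M_disjoint : ∀ x y z : N, InModel L x z → InModel L y z → x = y
  R_iff : ∀ x y : N, RRel L x y ↔ InModel L x y ∧ IsNode L y
  R_iff_pred : ∀ x y : N, RRel L x y ↔
    Structure.RelMap (L := starLang L) (n := 2) (StarRelations.lift p) ![x, y]
  rel_sort : ∀ (k : ℕ) (S : L.Relations k) (x : Fin (k + 1) → N),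
    Structure.RelMap (L := starLang L) (n := k + 1) (StarRelations.lift S) x →
      IsNode L (x 0) ∧ ∀ i : Fin k, InModel L (x 0) (x i.succ)
  fun_mem : ∀ (k : ℕ) (f : L.Functions k) (x : Fin (k + 1) → N),
    (IsNode L (x 0) ∧ ∀ i : Fin k, InModel L (x 0) (x i.succ)) → InModel L (x 0)
      (Structure.funMap (L := starLang L) (n := k + 1) (StarFunctions.lift f) x)
  fun_junk : ∀ (k : ℕ) (f : L.Functions k) (x : Fin (k + 1) → N),
    ¬ (IsNode L (x 0) ∧ ∀ i : Fin k, InModel L (x 0) (x i.succ)) →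
      Structure.funMap (L := starLang L) (n := k + 1) (StarFunctions.lift f) x = x 0
  models : ∀ u : N, IsNode L u → (relativize φ).Realize (fun _ : Fin 1 => u)

theorem models_iff {M : Type u} {L : FirstOrder.Language.{v, w}} [L.Structure M]
    {a : InfFormula L 0} : a.Models M ↔ a.Realize (default : Fin 0 → M) := Iff.rfl

theorem realize_relMember {x : Fin n → N} {t : (starLang L).Term (Fin n)} {i : Fin n} :
    (InfFormula.rel (L := starLang L) (k := 2) StarRelations.M ![Term.var i, t]).Realize x ↔
      InModel L (x i) (t.realize x) := by
  have : (fun l => ((![Term.var i, t] : Fin 2 → (starLang L).Term (Fin n)) l).realize x) =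
      ![x i, t.realize x] := by
    funext j; fin_cases j <;> rfl
  simp only [InfFormula.Realize, this]; rfl

theorem realize_manyBranches {u : N} :
    (conj fun m => allN m (ex
      (and (and (F (Fin.last (1 + m))) (ex (E (Fin.last (1 + m + 1)) (Fin.last (1 + m)).castSucc 0)))
        (iConj fun i : Fin m => not (eq (Fin.last (1 + m)) (i.natAdd 1).castSucc)))) :
          InfFormula (starLang L) 1).Realize (fun _ => u) ↔
      ∀ m (g : Fin m → N), ∃ f, (IsF L f ∧ ∃ k, ERel L k f u) ∧ ∀ i, f ≠ g i := by
  -- The node is variable 0, read past `m` branch variables and two witnesses. As `m` is arbitrary,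
  -- the index must be exhibited as an iterated cast before it can be evaluated.
  have h0 : ∀ (m : ℕ) (g : Fin m → N) (f k : N),
      (Fin.snoc (Fin.snoc (Fin.append (fun _ : Fin 1 => u) g) f : Fin (1 + m + 1) → N) k :
        Fin (1 + m + 1 + 1) → N) 0 = u := by
    intro m g f k
    have : (0 : Fin (1 + m + 1 + 1)) = (Fin.castAdd m (0 : Fin 1)).castSucc.castSucc := by
      ext; simp
    rw [this, Fin.snoc_castSucc, Fin.snoc_castSucc, Fin.append_left]
  simp only [realize_conj', realize_allN, realize_ex, realize_and', realize_iConj', realize_not,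
    realize_eq, realize_F, realize_E, Fin.snoc_last, Fin.snoc_castSucc, Fin.append_right, h0, ne_eq]

/-- The only passage between syntax and semantics of `φ*`: one direction extracts the axioms from
the given models, the other certifies the constructed tree. -/
theorem models_starSentence_iff [Countable (Σ k, L.Functions k)] [Countable (Σ k, L.Relations k)]
    {φ : InfFormula L 0} {p : L.Relations 1} :
    (starSentence φ p).Models N ↔ IsStarModel φ p N := by
  have e0 : ∀ y : N, (Fin.snoc (default : Fin 0 → N) y : Fin 1 → N) = fun _ => y := by
    intro y; funext i; fin_cases i; rfl
  rw [models_iff, starSentence, realize_listConj]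
  simp only [List.forall_mem_append]
  simp only [sortAxioms, treeAxioms, branchAxioms, modelAxioms, List.forall_mem_cons]
  constructor
  · rintro ⟨⟨⟨⟨s1, s2, s3, s4, s5, s6, s7, s8, -⟩, t1, t2, t3, t4, t5, -⟩, b1, b2, b3, b4, b5, -⟩,
      m1, m2, m3, m4, m5, m6, m7, -⟩
    simp [Fin.snoc] at s1 s2 s3 s4 s5 s6 s7 s8
    simp [Fin.snoc] at t1 t2 t3 t4 t5
    simp [Fin.snoc] at b1 b2 b3 b4
    simp [Fin.snoc] at m1 m2 m3
    refine ⟨s1, s2, s3, s4, s5, s6, s7, s8, t1, t2, t3, t4, t5, b1, b2, b3, b4, fun u hu => ?_,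
      m1, m2, m3, fun k S x hx => ?_, fun k f x hx => ?_, fun k f x hx => ?_, fun u hu => ?_⟩
    · refine realize_manyBranches.1 ?_
      rw [← e0]
      exact b5 u (realize_V.2 (by simpa [Fin.snoc] using hu))
    · exact realize_inNode.1 (models_alls.1 (realize_iConj.1 m4 ⟨k, S⟩) x hx)
    · exact realize_relMember.1 (models_alls.1 (realize_iConj.1 m5 ⟨k, f⟩) x (realize_inNode.2 hx))
    · exact models_alls.1 (realize_iConj.1 m6 ⟨k, f⟩) x (fun h => hx (realize_inNode.1 h))
    · rw [← e0]
      exact m7 u (realize_V.2 (by simpa [Fin.snoc] using hu))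
  · intro h
    refine ⟨⟨⟨⟨?_, ?_, ?_, ?_, ?_, ?_, ?_, ?_, by simp⟩, ?_, ?_, ?_, ?_, ?_, by simp⟩,
      ?_, ?_, ?_, ?_, ?_, by simp⟩, ?_, ?_, ?_, ?_, ?_, ?_, ?_, by simp⟩
    · simpa [Fin.snoc] using h.not_K_V
    · simpa [Fin.snoc] using h.not_K_F
    · simpa [Fin.snoc] using h.not_V_F
    · simpa [Fin.snoc] using h.cover
    · simpa [Fin.snoc] using h.H_sort
    · simpa [Fin.snoc] using h.R_sort
    · simpa [Fin.snoc] using h.E_sort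
    · simpa [Fin.snoc] using h.M_sort
    · simpa [Fin.snoc] using h.root
    · simpa [Fin.snoc] using h.pred_unique
    · simpa [Fin.snoc] using h.exists_level
    · simpa [Fin.snoc] using h.exists_num
    · simpa [Fin.snoc] using h.hasNum
    · simpa [Fin.snoc] using h.E_exists
    · simpa [Fin.snoc] using h.E_level
    · simpa [Fin.snoc] using h.E_step
    · simpa [Fin.snoc] using h.F_ext
    · intro u hu
      rw [e0] at hu ⊢
      exact realize_manyBranches.2 (h.F_infinite u (realize_V.1 hu))
    · simpa [Fin.snoc] using h.M_disjoint
    · simpa [Fin.snoc] using h.R_iff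
    · simpa [Fin.snoc] using h.R_iff_pred
    · exact realize_iConj.2 fun S => models_alls.2 fun x hx =>
        realize_inNode.2 (h.rel_sort S.1 S.2 x hx)
    · exact realize_iConj.2 fun f => models_alls.2 fun x hx =>
        realize_relMember.2 (h.fun_mem f.1 f.2 x (realize_inNode.1 hx))
    · exact realize_iConj.2 fun f => models_alls.2 fun x hx =>
        h.fun_junk f.1 f.2 x fun h' => hx (realize_inNode.2 h')
    · intro u hu
      rw [e0] at hu ⊢
      exact h.models u (realize_V.1 hu)

/-! ### Relativization -/

/-- The map `ι` identifies the `L`-structure `A` with the model attached to `u`. -/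
structure IsAttached {A : Type u} [L.Structure A] (u : N) (ι : A → N) : Prop where
  injective : Function.Injective ι
  inModel_iff : ∀ x, InModel L u x ↔ ∃ a, ι a = x
  rel_iff : ∀ (k : ℕ) (S : L.Relations k) (a : Fin k → A),
    Structure.RelMap (L := starLang L) (n := k + 1) (StarRelations.lift S)
      (Fin.cons u fun i => ι (a i)) ↔ Structure.RelMap S a
  fun_eq : ∀ (k : ℕ) (f : L.Functions k) (a : Fin k → A),
    Structure.funMap (L := starLang L) (n := k + 1) (StarFunctions.lift f)
      (Fin.cons u fun i => ι (a i)) = ι (Structure.funMap f a)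

variable {A : Type u} [L.Structure A] {u : N} {ι : A → N}

theorem realize_args {k : ℕ} (t : Fin k → (starLang L).Term (Fin (n + 1))) (x : Fin n → N) :
    (fun i => (Fin.cons (α := fun _ => (starLang L).Term (Fin (n + 1))) (.var 0) t i).realize
      (Fin.cons u x : Fin (n + 1) → N)) =
      (Fin.cons u fun i => (t i).realize (Fin.cons u x) : Fin (k + 1) → N) := by
  funext i
  refine Fin.cases ?_ (fun i => ?_) i <;> simp

theorem IsAttached.realize_relTerm (h : IsAttached (L := L) u ι) (t : L.Term (Fin n))
    (x : Fin n → A) :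
    (relTerm t).realize (Fin.cons u fun i => ι (x i) : Fin (n + 1) → N) = ι (t.realize x) := by
  induction t with
  | var i => simp [relTerm]
  | func f ts ih =>
    rw [Term.realize_func, ← h.fun_eq]
    simp only [← ih]
    exact congrArg (Structure.funMap (L := starLang L) (StarFunctions.lift f)) (realize_args _ _)

/-- Relativized quantifiers range over `M(u, ·)`, which is exactly the range of `ι`. Two different
presentations of the same attached model therefore satisfy the same formulas, which is how
elementarity is transferred later. -/
theorem IsAttached.realize_relativize (h : IsAttached (L := L) u ι) (a : InfFormula L n)
    (x : Fin n → A) :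
    (relativize a).Realize (Fin.cons u fun i => ι (x i) : Fin (n + 1) → N) ↔ a.Realize x := by
  induction a with
  | falsum => exact Iff.rfl
  | equal t s =>
    simp only [relativize, realize_equal', h.realize_relTerm, h.injective.eq_iff]
  | rel S ts =>
    simp only [relativize, InfFormula.Realize, ← h.rel_iff]
    rw [realize_args]
    simp only [h.realize_relTerm]
  | imp a b iha ihb => simp only [relativize, realize_imp', iha, ihb]
  | @all n a ih =>
    have key : ∀ y, (Fin.snoc (Fin.cons u fun i => ι (x i) : Fin (n + 1) → N) (ι y) :
        Fin (n + 2) → N) = Fin.cons u fun i => ι ((Fin.snoc x y : Fin (n + 1) → A) i) := by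
      intro y
      rw [← Fin.cons_snoc_eq_snoc_cons]
      congr 1
      funext i
      refine Fin.lastCases ?_ (fun i => ?_) i <;> simp
    simp only [relativize, realize_all', realize_imp', realize_M, Fin.snoc_last]
    have h0 : ∀ y : N, (Fin.snoc (Fin.cons u fun i => ι (x i) : Fin (n + 1) → N) y :
        Fin (n + 2) → N) 0 = u := by
      intro y
      rw [← Fin.cons_snoc_eq_snoc_cons, Fin.cons_zero]
    simp only [h0, h.inModel_iff]
    constructor
    · intro hy y
      have := hy (ι y) ⟨y, rfl⟩
      rwa [key, ih] at this
    · rintro hy _ ⟨y, rfl⟩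
      rw [key, ih]
      exact hy y
  | conj a ih => simp only [relativize, realize_conj', ih]

theorem IsAttached.models_iff (h : IsAttached (L := L) u ι) (φ : InfFormula L 0) :
    (relativize φ).Realize (fun _ : Fin 1 => u) ↔ φ.Models A := by
  refine Iff.trans (iff_of_eq ?_) (h.realize_relativize φ default)
  congr 1
  funext i
  fin_cases i
  rfl

variable [Countable (Σ k, L.Functions k)] [Countable (Σ k, L.Relations k)]
  {φ : InfFormula L 0} {p : L.Relations 1}

theorem isAttached_nodeModel (hN : (starSentence φ p).Models N) (u : N) (hu : IsNode L u) :
    IsAttached (L := L) u (fun x : NodeModel hN u hu => x.1) where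
  injective := Subtype.val_injective
  inModel_iff x := ⟨fun h => ⟨⟨x, h⟩, rfl⟩, by rintro ⟨a, rfl⟩; exact a.2⟩
  rel_iff _ _ _ := Iff.rfl
  fun_eq _ _ _ := rfl

theorem models_nodeModel (hN : (starSentence φ p).Models N) (u : N) (hu : IsNode L u) :
    φ.Models (NodeModel hN u hu) :=
  ((isAttached_nodeModel hN u hu).models_iff φ).1 ((models_starSentence_iff.1 hN).models u hu)

end Star

/-! ## The predicate of indiscernibles -/

section PredSet

open InfFormula

variable {L : FirstOrder.Language.{v, w}}

theorem embedding_mem_predSet {A B : Type u} [L.Structure A] [L.Structure B] {p : L.Relations 1} (g : A ↪[L] B)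
    {x : A} :
    g x ∈ predSet p B ↔ x ∈ predSet p A := by
  refine Iff.trans (iff_of_eq ?_) (g.map_rel p ![x])
  change Structure.RelMap p _ = _
  congr 1
  funext i
  fin_cases i
  rfl

/-- The sentence saying that the predicate `P` is infinite. -/
noncomputable def predInfinite (P : L.Relations 1) : InfFormula L 0 :=
  conj fun m => alls (n := m) (ex (and (rel P ![Term.var (Fin.last m)])
    (iConj fun i : Fin m => not (equal (Term.var (Fin.last m)) (Term.var i.castSucc)))))

theorem models_predInfinite {P : L.Relations 1} {M : Type u} [L.Structure M] :
    (predInfinite P).Models M ↔ (predSet P M).Infinite := by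
  have h1 : ∀ (m : ℕ) (x : Fin m → M) (y : M),
      (rel P ![Term.var (Fin.last m)] : InfFormula L (m + 1)).Realize (Fin.snoc x y) ↔
        y ∈ predSet P M := by
    intro m x y
    simp only [InfFormula.Realize, predSet, Set.mem_ofPred_eq]
    refine iff_of_eq ?_
    congr 1
    funext j
    fin_cases j
    simp
  have h2 : (predInfinite P).Models M ↔
      ∀ (m : ℕ) (x : Fin m → M), ∃ y ∈ predSet P M, ∀ i, y ≠ x i := by
    have : (predInfinite P).Models M ↔ ∀ m, (alls (n := m) (ex (and (rel P ![Term.var (Fin.last m)])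
        (iConj fun i : Fin m =>
          not (equal (Term.var (Fin.last m)) (Term.var i.castSucc)))))).Models M := Iff.rfl
    simp only [this, models_alls, realize_ex, realize_and', h1, realize_iConj', realize_not,
      realize_equal', Term.realize_var, Fin.snoc_last, Fin.snoc_castSucc, ne_eq]
  rw [h2]
  constructor
  · intro h hfin
    -- Were the predicate finite, its own enumeration could serve as the list to be avoided.
    obtain ⟨y, hy, hne⟩ := h hfin.toFinset.card (fun i => (hfin.toFinset.equivFin.symm i).1)
    exact hne (hfin.toFinset.equivFin ⟨y, hfin.mem_toFinset.2 hy⟩) (by simp)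
  · intro h m x
    obtain ⟨y, hy, hne⟩ := h.exists_notMem_finite (Set.finite_range x)
    exact ⟨y, hy, fun i hi => hne ⟨i, hi.symm⟩⟩

/-- Completeness carries the infinitude of `P` from the model with absolute indiscernibles to all
models of `φ`. -/
theorem HomogeneouslyCharacterizes.predSet_infinite {φ : InfFormula L 0} {P : L.Relations 1}
    {κ : Cardinal.{u}} (h : HomogeneouslyCharacterizes φ P κ) {M : Type u} [L.Structure M]
    (hM : φ.Models M) : (predSet P M).Infinite := by
  refine models_predInfinite.1 ?_
  obtain ⟨C, _, -, hC, hP, -⟩ := h.indiscernible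
  rcases h.complete.2 (predInfinite P) with h' | h'
  · exact h' M hM
  · exact absurd (models_predInfinite.2 hP) (h' C hC)

end PredSet

/-! ## Trees of models -/

/-- A recipe for a tree of models of `φ`: every node has a state, which determines the model attached
to the node, and `next` gives the state of an immediate successor. -/
structure TreeData {L : FirstOrder.Language.{v, w}} (φ : InfFormula L 0) (p : L.Relations 1) where
  State : Type u
  start : State
  Model : State → Type u
  [str : ∀ s, L.Structure (Model s)]
  models : ∀ s, φ.Models (Model s)
  infinite : ∀ s, (predSet p (Model s)).Infinite
  next : (Σ s, Model s) → State

attribute [instance] TreeData.str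

namespace TreeData

open Star InfFormula

variable {L : FirstOrder.Language.{v, w}} {φ : InfFormula L 0} {p : L.Relations 1}
  (D : TreeData.{u} φ p)

/-- An element of one of the models. -/
abbrev Letter : Type u := Σ s, D.Model s

/-- The state at the end of a sequence of elements, the latest of which comes first. -/
def state : List D.Letter → D.State
  | [] => D.start
  | y :: _ => D.next y

/-- The sequence `l` continued by an element of the model attached to its end. -/
def ext (l : List D.Letter) (a : D.Model (D.state l)) : List D.Letter := ⟨D.state l, a⟩ :: l

/-- The sequences that are nodes of the tree. -/
inductive IsPath : List D.Letter → Prop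
  | nil : IsPath []
  | ext {l : List D.Letter} (hl : IsPath l) {a : D.Model (D.state l)} (ha : a ∈ predSet p _) :
      IsPath (D.ext l a)

/-- The nodes of the tree. -/
abbrev Path : Type u := {l : List D.Letter // D.IsPath l}

/-- The infinite branches of the tree. -/
structure Branch : Type u where
  toFun : ℕ → D.Path
  length_eq : ∀ n, (toFun n).1.length = n
  tail_eq : ∀ n, (toFun (n + 1)).1.tail = (toFun n).1

/-- The universe of the structure: the natural numbers, the root together with the elements of the
attached models, and the branches. -/
inductive Point : Type u
  | num (n : ℕ) : Point
  | elem (x : {x : List D.Letter // x = [] ∨ ∃ (l : D.Path) (a : _), x = D.ext l.1 a}) : Point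
  | branch (b : D.Branch) : Point

variable {D}

/-! ### Paths and branches of the tree. -/

theorem ext_injective {l : List D.Letter} : Function.Injective (D.ext l) := by
  intro a b h
  simpa [ext] using h

theorem IsPath.exists_eq {l : List D.Letter} (h : D.IsPath l) :
    l = [] ∨ ∃ (t : D.Path) (a : _), l = D.ext t.1 a := by
  cases h with
  | nil => exact Or.inl rfl
  | ext hl ha => exact Or.inr ⟨⟨_, hl⟩, _, rfl⟩

theorem isPath_ext_iff {l : D.Path} {a : D.Model (D.state l.1)} :
    D.IsPath (D.ext l.1 a) ↔ a ∈ predSet p _ := by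
  refine ⟨fun h => ?_, fun h => .ext l.2 h⟩
  generalize hx : D.ext l.1 a = x at h
  cases h with
  | nil => simp [ext] at hx
  | @ext t ht b hb =>
    have ht : l.1 = t := (List.cons.inj hx).2
    subst ht
    rwa [ext_injective hx]

theorem IsPath.tail {l : List D.Letter} (h : D.IsPath l) : D.IsPath l.tail := by
  cases h with
  | nil => exact .nil
  | ext hl ha => exact hl

theorem IsPath.drop {l : List D.Letter} (h : D.IsPath l) (k : ℕ) : D.IsPath (l.drop k) := by
  induction k with
  | zero => exact h
  | succ k ih => rw [← List.tail_drop]; exact ih.tail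

/-- The path can be prolonged forever because `P` is nonempty in every attached model. -/
theorem exists_branch (l : D.Path) : ∃ b : D.Branch, b.toFun l.1.length = l := by
  choose c hc using fun s => (D.infinite s).nonempty
  let grow : D.Path → D.Path := fun l => ⟨D.ext l.1 (c _), .ext l.2 (hc _)⟩
  have hlen : ∀ n, (grow^[n] l).1.length = n + l.1.length := by
    intro n
    induction n with
    | zero => simp
    | succ n ih =>
      rw [Function.iterate_succ_apply', add_right_comm, ← ih]
      rfl
  have hdrop : ∀ n, (grow^[n] l).1.drop n = l.1 := by
    intro n
    induction n with
    | zero => simp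
    | succ n ih => rw [Function.iterate_succ_apply']; simpa [grow, ext] using ih
  -- The `n`-th iterate has `n + l.length` letters, newest first, so dropping `l.length` of them
  -- leaves the oldest `n`. This treats the initial segments of `l` and its prolongations uniformly.
  refine ⟨⟨fun n => ⟨(grow^[n] l).1.drop l.1.length, (grow^[n] l).2.drop _⟩, fun n => ?_,
    fun n => ?_⟩, ?_⟩
  · simp [hlen]
  · rw [Function.iterate_succ_apply', List.tail_drop]
    simp [grow, ext]
  · exact Subtype.ext (hdrop _)

theorem exists_path (n : ℕ) : ∃ l : D.Path, l.1.length = n := by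
  obtain ⟨b, -⟩ := exists_branch (⟨[], .nil⟩ : D.Path)
  exact ⟨b.toFun n, b.length_eq n⟩

/-- The node `l` as an element of the universe. -/
def node (l : D.Path) : D.Point := .elem ⟨l.1, l.2.exists_eq⟩

/-- The element `a` of the model attached to `l` as an element of the universe. -/
def child (l : D.Path) (a : D.Model (D.state l.1)) : D.Point := .elem ⟨D.ext l.1 a, Or.inr ⟨l, a, rfl⟩⟩

theorem node_inj {l t : D.Path} : node l = node t ↔ l = t := by
  simp [node, Subtype.ext_iff]

theorem child_eq_node {l t : D.Path} {a : D.Model (D.state l.1)} :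
    child l a = node t ↔ D.ext l.1 a = t.1 := by
  simp [node, child]

theorem child_injective (l : D.Path) : Function.Injective (child l) := by
  intro a b h
  simp only [child, Point.elem.injEq, Subtype.mk.injEq] at h
  exact ext_injective h

theorem path_eq_of_child_eq {l t : D.Path} {a : D.Model (D.state l.1)} {b : D.Model (D.state t.1)}
    (h : child l a = child t b) : l = t := by
  exact Subtype.ext (List.cons.inj (congrArg Subtype.val (Point.elem.inj h))).2

/-- This is why `R(u, ·)`, `M(u, ·) ∩ V` and `P(u, ·)` coincide in the tree: elements outside `P`
belong to an attached model but are never prolonged. -/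
theorem child_mem_range_node {l : D.Path} {a : D.Model (D.state l.1)} :
    (∃ t, child l a = node t) ↔ a ∈ predSet p _ := by
  simp only [child_eq_node]
  exact ⟨fun ⟨t, ht⟩ => isPath_ext_iff.1 (ht ▸ t.2), fun h => ⟨⟨_, .ext l.2 h⟩, rfl⟩⟩

/-- Membership in the model attached to a node. -/
def MemModel (x y : D.Point) : Prop := ∃ l a, x = node l ∧ y = child l a

open Classical in
/-- The tree of models as a structure. -/
noncomputable instance : (starLang L).Structure D.Point where
  funMap {_} f := match f with
    | @StarFunctions.lift _ k f => fun x =>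
      if h : ∃ (l : D.Path) (a : Fin k → D.Model (D.state l.1)), x = Fin.cons (node l) (fun i => child l (a i)) then
        child h.choose (Structure.funMap f h.choose_spec.choose) else x 0
  RelMap {_} S := match S with
    | StarRelations.K => fun x => ∃ n, x 0 = .num n
    | StarRelations.V => fun x => ∃ l, x 0 = node l
    | StarRelations.F => fun x => ∃ b, x 0 = .branch b
    | StarRelations.H => fun x => ∃ l : D.Path, x 0 = .num l.1.length ∧ x 1 = node l
    | StarRelations.R => fun x => MemModel (x 0) (x 1) ∧ ∃ l, x 1 = node l
    | StarRelations.E => fun x => ∃ n b, x 0 = .num n ∧ x 1 = .branch b ∧ x 2 = node (b.toFun n)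
    | StarRelations.M => fun x => MemModel (x 0) (x 1)
    | @StarRelations.lift _ k S => fun x => ∃ (l : D.Path) (a : Fin k → D.Model (D.state l.1)),
        x = Fin.cons (node l) (fun i => child l (a i)) ∧ Structure.RelMap S a

/-! ### The symbols of the vocabulary evaluated in the tree. -/

theorem hRel_iff {x y : D.Point} :
    HRel L x y ↔ ∃ l : D.Path, x = .num l.1.length ∧ y = node l := Iff.rfl

theorem inModel_iff {x y : D.Point} : InModel L x y ↔ ∃ l a, x = node l ∧ y = child l a := Iff.rfl

theorem rRel_iff {x y : D.Point} : RRel L x y ↔ InModel L x y ∧ IsNode L y := Iff.rfl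

theorem eRel_iff {x y z : D.Point} :
    ERel L x y z ↔ ∃ n b, x = .num n ∧ y = .branch b ∧ z = node (b.toFun n) := Iff.rfl

theorem rRel_node_iff {l : D.Path} {x : D.Point} :
    RRel L x (node l) ↔ ∃ t : D.Path, x = node t ∧ l.1.length = t.1.length + 1 ∧ l.1.tail = t.1 := by
  rw [rRel_iff, inModel_iff]
  constructor
  · rintro ⟨⟨t, a, rfl, h⟩, -⟩
    have := child_eq_node.1 h.symm
    exact ⟨t, rfl, by simp [← this, ext], by simp [← this, ext]⟩
  · rintro ⟨t, rfl, h1, h2⟩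
    rcases l.2.exists_eq with h | ⟨t', a, h⟩
    · simp [h] at h1
    · obtain rfl : t' = t := Subtype.ext (by rw [← h2, h]; rfl)
      exact ⟨⟨t', a, rfl, (child_eq_node.2 h.symm).symm⟩, l, rfl⟩

theorem hasLevel_iff {m : ℕ} {x : D.Point} :
    HasLevel L m x ↔ ∃ l : D.Path, x = node l ∧ l.1.length = m := by
  induction m generalizing x with
  | zero =>
    constructor
    · rintro ⟨⟨l, rfl⟩, h⟩
      refine ⟨l, rfl, ?_⟩
      rcases hl : l.1 with _ | ⟨y, t⟩
      · rfl
      · exact absurd ⟨node ⟨t, by simpa [hl] using l.2.tail⟩,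
          rRel_node_iff.2 ⟨_, rfl, by simp [hl], by simp [hl]⟩⟩ h
    · rintro ⟨l, rfl, h⟩
      refine ⟨⟨l, rfl⟩, ?_⟩
      rintro ⟨y, hy⟩
      obtain ⟨t, -, ht, -⟩ := rRel_node_iff.1 hy
      omega
  | succ m ih =>
    constructor
    · rintro ⟨y, hy, hm⟩
      obtain ⟨l, rfl⟩ := (rRel_iff.1 hy).2
      obtain ⟨t, rfl, ht, -⟩ := rRel_node_iff.1 hy
      obtain ⟨t', h, rfl⟩ := ih.1 hm
      exact ⟨l, rfl, by rw [ht, node_inj.1 h]⟩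
    · rintro ⟨l, rfl, h⟩
      exact ⟨node ⟨l.1.tail, l.2.tail⟩, rRel_node_iff.2 ⟨_, rfl, by simp; omega, rfl⟩,
        ih.2 ⟨_, rfl, by simp; omega⟩⟩

theorem hRel_num_iff {n : ℕ} {x : D.Point} : HRel L (.num n) x ↔ HasLevel L n x := by
  rw [hRel_iff, hasLevel_iff]
  constructor
  · rintro ⟨l, h, rfl⟩
    exact ⟨l, rfl, (Point.num.inj h).symm⟩
  · rintro ⟨l, rfl, rfl⟩
    exact ⟨l, rfl, rfl⟩

theorem hasLevel_node {l : D.Path} {m : ℕ} : HasLevel L m (node l) ↔ l.1.length = m := by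
  rw [hasLevel_iff]
  constructor
  · rintro ⟨t, h, rfl⟩
    rw [node_inj.1 h]
  · rintro rfl
    exact ⟨l, rfl, rfl⟩

/-- An element of `K` is identified only through the nodes on its level, so distinct numbers are
told apart because every level is inhabited (`exists_path`). -/
theorem hasNum_iff {m : ℕ} {x : D.Point} : HasNum L m x ↔ x = .num m := by
  constructor
  · rintro ⟨⟨n, rfl⟩, h⟩
    obtain ⟨l, rfl⟩ := exists_path (D := D) n
    have := (h (node l)).1 (hRel_num_iff.2 (hasLevel_node.2 rfl))
    rw [hasLevel_node.1 this]
  · rintro rfl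
    exact ⟨⟨m, rfl⟩, fun y => hRel_num_iff⟩

theorem isAttached_child (l : D.Path) : IsAttached (L := L) (node l) (child l) where
  injective := child_injective l
  inModel_iff x := by
    rw [inModel_iff]
    constructor
    · rintro ⟨t, a, h, rfl⟩
      obtain rfl := node_inj.1 h
      exact ⟨a, rfl⟩
    · rintro ⟨a, rfl⟩
      exact ⟨l, a, rfl, rfl⟩
  rel_iff k S a := by
    constructor
    · rintro ⟨t, b, h, hS⟩
      obtain ⟨h1, h2⟩ := Fin.cons_inj.1 h
      obtain rfl := node_inj.1 h1
      rwa [funext fun i => child_injective l (congrFun h2 i)]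
    · exact fun h => ⟨l, a, rfl, h⟩
  fun_eq k f a := by
    have h : ∃ (t : D.Path) (b : Fin k → D.Model (D.state t.1)),
        (Fin.cons (node l) (fun i => child l (a i)) : Fin (k + 1) → D.Point) =
        Fin.cons (node t) (fun i => child t (b i)) := ⟨l, a, rfl⟩
    -- The function symbols are interpreted through a chosen decomposition of the arguments; the
    -- value does not depend on that choice.
    have key : ∀ (t : D.Path) (b : Fin k → D.Model (D.state t.1)),
        (Fin.cons (node l) (fun i => child l (a i)) : Fin (k + 1) → D.Point) =
        Fin.cons (node t) (fun i => child t (b i)) →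
        child t (Structure.funMap f b) = child l (Structure.funMap f a) := by
      intro t b h
      obtain ⟨h1, h2⟩ := Fin.cons_inj.1 h
      obtain rfl := node_inj.1 h1
      rw [funext fun i => child_injective l (congrFun h2 i)]
    exact (dif_pos h).trans (key _ _ h.choose_spec.choose_spec)

/-- The node `l` has infinitely many successors, while finitely many given branches meet only
finitely many of them; prolong `l` through a fresh one. -/
theorem exists_branch_avoiding (l : D.Path) (m : ℕ) (g : Fin m → D.Point) :
    ∃ b : D.Branch, b.toFun l.1.length = l ∧ ∀ i, .branch b ≠ g i := by
  let val : D.Point → List D.Letter := fun x => match x with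
    | .branch b => (b.toFun (l.1.length + 1)).1
    -- Points that are not branches get a dummy value, which merely adds one more list to the finite
    -- set avoided.
    | _ => []
  have hinf : (D.ext l.1 '' predSet p _).Infinite :=
    (D.infinite _).image ext_injective.injOn
  obtain ⟨_, ⟨a, ha, rfl⟩, hne⟩ := hinf.exists_notMem_finite (Set.finite_range fun i => val (g i))
  obtain ⟨b, hb⟩ := exists_branch (⟨_, .ext l.2 ha⟩ : D.Path)
  replace hb : (b.toFun (l.1.length + 1)).1 = D.ext l.1 a := congrArg Subtype.val hb
  refine ⟨b, Subtype.ext ?_, fun i hi => hne ⟨i, ?_⟩⟩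
  · rw [← b.tail_eq, hb]; rfl
  · simp only [← hi, val, hb]

theorem isStarModel : IsStarModel φ p D.Point where
  not_K_V := by rintro _ ⟨n, rfl⟩ ⟨l, h⟩; cases h
  not_K_F := by rintro _ ⟨n, rfl⟩ ⟨l, h⟩; cases h
  not_V_F := by rintro _ ⟨n, rfl⟩ ⟨l, h⟩; cases h
  cover x := by
    match x with
    | .num n => exact Or.inl ⟨n, rfl⟩
    | .branch b => exact Or.inr (Or.inr (Or.inl ⟨b, rfl⟩))
    | .elem ⟨x, hx⟩ =>
      rcases hx with rfl | ⟨l, a, rfl⟩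
      · exact Or.inr (Or.inl ⟨⟨[], .nil⟩, rfl⟩)
      · exact Or.inr (Or.inr (Or.inr ⟨node l, l, a, rfl, rfl⟩))
  H_sort := by rintro _ _ ⟨l, rfl, rfl⟩; exact ⟨⟨_, rfl⟩, l, rfl⟩
  R_sort := by rintro _ _ ⟨⟨l, a, rfl, rfl⟩, h⟩; exact ⟨⟨l, rfl⟩, h⟩
  E_sort := by rintro _ _ _ ⟨n, b, rfl, rfl, rfl⟩; exact ⟨⟨n, rfl⟩, ⟨b, rfl⟩, _, rfl⟩
  M_sort := by
    rintro _ _ ⟨l, a, rfl, rfl⟩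
    refine ⟨⟨l, rfl⟩, ?_, ?_⟩ <;> rintro ⟨n, h⟩ <;> cases h
  root := by
    refine ⟨node ⟨[], .nil⟩, hasLevel_iff.2 ⟨_, rfl, rfl⟩, fun x hx => ?_⟩
    obtain ⟨l, rfl, h⟩ := hasLevel_iff.1 hx
    exact node_inj.2 (Subtype.ext (List.length_eq_zero_iff.1 h))
  pred_unique := by
    rintro x y z hx hy
    obtain ⟨l, rfl⟩ := (rRel_iff.1 hx).2
    obtain ⟨t, rfl, -, h1⟩ := rRel_node_iff.1 hx
    obtain ⟨t', rfl, -, h2⟩ := rRel_node_iff.1 hy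
    rw [Subtype.ext (h1.symm.trans h2)]
  exists_level := by rintro _ ⟨l, rfl⟩; exact ⟨_, hasLevel_node.2 rfl⟩
  exists_num m := ⟨.num m, hasNum_iff.2 rfl, fun l hl => hasNum_iff.1 hl⟩
  hasNum := by rintro _ ⟨n, rfl⟩; exact ⟨n, hasNum_iff.2 rfl⟩
  E_exists := by
    rintro _ _ ⟨n, rfl⟩ ⟨b, rfl⟩
    refine ⟨_, ⟨n, b, rfl, rfl, rfl⟩, ?_⟩
    rintro _ ⟨n', b', h1, h2, rfl⟩
    cases h1; cases h2; rfl
  E_level := by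
    rintro _ _ _ ⟨n, b, rfl, rfl, rfl⟩
    exact hRel_num_iff.2 (hasLevel_node.2 (b.length_eq n))
  E_step := by
    rintro _ _ _ _ _ z ⟨n, b, rfl, rfl, rfl⟩ ⟨n', b', rfl, h, rfl⟩ hR hH
    cases h
    obtain ⟨t, rfl⟩ := (rRel_iff.1 hR).2
    obtain ⟨t', h1, h2, -⟩ := rRel_node_iff.1 hR
    -- The auxiliary successor `z` serves only to force `n' = n + 1`.
    have h3 := hasLevel_node.1 (hRel_num_iff.1 hH)
    rw [← node_inj.1 h1, b.length_eq, h3] at h2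
    subst h2
    exact rRel_node_iff.2 ⟨_, rfl, by simp [b.length_eq], b.tail_eq n⟩
  F_ext := by
    rintro _ _ ⟨b, rfl⟩ ⟨c, rfl⟩ hne
    by_contra! h
    refine hne ?_
    have : b.toFun = c.toFun := by
      funext n
      obtain ⟨n', c', h1, h2, h3⟩ := h (.num n) (node (b.toFun n)) ⟨n, b, rfl, rfl, rfl⟩
      cases h1; cases h2
      exact node_inj.1 h3
    cases b; cases c; cases this; rfl
  F_infinite := by
    rintro _ ⟨l, rfl⟩ m g
    obtain ⟨b, hb, hne⟩ := exists_branch_avoiding l m g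
    exact ⟨.branch b, ⟨⟨b, rfl⟩, .num l.1.length, _, b, rfl, rfl, (node_inj.2 hb).symm⟩, hne⟩
  M_disjoint := by
    rintro _ _ _ ⟨l, a, rfl, rfl⟩ ⟨t, b, rfl, h⟩
    rw [path_eq_of_child_eq h]
  R_iff x y := rRel_iff
  R_iff_pred x y := by
    rw [rRel_iff]
    constructor
    · rintro ⟨⟨l, a, rfl, rfl⟩, h⟩
      have ha : a ∈ predSet p _ := child_mem_range_node.1 h
      refine ⟨l, ![a], ?_, ha⟩
      funext i
      fin_cases i <;> rfl
    · rintro ⟨l, a, h, hS⟩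
      have h0 : x = node l := congrFun h 0
      have h1 : y = child l (a 0) := congrFun h 1
      subst h0 h1
      refine ⟨⟨l, a 0, rfl, rfl⟩, child_mem_range_node.2 ?_⟩
      have : a = ![a 0] := by funext i; fin_cases i; rfl
      rwa [this] at hS
  rel_sort := by
    rintro k S _ ⟨l, a, rfl, -⟩
    exact ⟨⟨l, rfl⟩, fun i => ⟨l, a i, rfl, rfl⟩⟩
  fun_mem := by
    rintro k f x ⟨⟨l, h0⟩, h⟩
    choose a ha using fun i => ((isAttached_child l).inModel_iff (x (Fin.succ i))).1 (h0 ▸ h i)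
    obtain rfl : (Fin.cons (node l) (fun i => child l (a i)) : Fin (k + 1) → D.Point) = x := by
      funext i
      refine Fin.cases h0.symm (fun i => ha i) i
    rw [(isAttached_child l).fun_eq]
    exact ⟨l, _, rfl, rfl⟩
  fun_junk := by
    rintro k f x hx
    refine dif_neg ?_
    rintro ⟨l, a, rfl⟩
    exact hx ⟨⟨l, rfl⟩, fun i => ⟨l, a i, rfl, rfl⟩⟩
  models := by
    rintro _ ⟨l, rfl⟩
    exact ((isAttached_child l).models_iff φ).2 (D.models _)

end TreeData

/-! ## Embedding a model of `φ*` into a tree of models -/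

section LabelledTrees

open Star InfFormula

variable {L : FirstOrder.Language.{v, w}} [Countable (Σ k, L.Functions k)]
  [Countable (Σ k, L.Relations k)] {φ : InfFormula L 0} {p : L.Relations 1}

/-- An assignment of nodes of `N` to the states of `D`, with elementary embeddings of the attached
models, that is compatible with passing to immediate successors. -/
structure Labelling (D : TreeData.{u} φ p) {N : Type u} [(starLang L).Structure N]
    (hN : (starSentence φ p).Models N) where
  label : D.State → {u : N // IsNode L u}
  emb : ∀ s, NodeModel hN (label s).1 (label s).2 ↪[L] D.Model s
  elementary : ∀ s, φ.IsElementary (emb s)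
  start : HasLevel L 0 (label D.start).1
  next : ∀ s (x : NodeModel hN (label s).1 (label s).2) (hx : IsNode L x.1),
    label (D.next ⟨s, emb s x⟩) = ⟨x.1, hx⟩

/-! ### Coding the nodes of a model by paths. -/

namespace Labelling

variable {D : TreeData.{u} φ p} {N : Type u} [(starLang L).Structure N]
  {hN : (starSentence φ p).Models N} (Λ : Labelling D hN)

theorem mem_predSet_iff {u : N} {hu : IsNode L u} (x : NodeModel hN u hu) :
    x ∈ predSet p (NodeModel hN u hu) ↔ IsNode L x.1 := by
  have h := models_starSentence_iff.1 hN
  have h1 : x ∈ predSet p (NodeModel hN u hu) ↔ RRel L u x.1 := by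
    rw [h.R_iff_pred]
    refine iff_of_eq ?_
    change Structure.RelMap (L := starLang L) (StarRelations.lift p) _ = _
    congr 1
    funext i
    fin_cases i <;> rfl
  rw [h1, h.R_iff]
  exact and_iff_right x.2

/-- The node of `N` that labels the path `l`. -/
def dec (l : D.Path) : {u : N // IsNode L u} := Λ.label (D.state l.1)

/-- The paths that come from nodes of `N`. -/
inductive Legit : D.Path → Prop
  | nil : Legit ⟨[], .nil⟩
  | ext {l : D.Path} (hl : Legit l) (x : NodeModel hN (Λ.dec l).1 (Λ.dec l).2) (hx : IsNode L x.1)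
      (h : D.IsPath (D.ext l.1 (Λ.emb _ x))) : Legit ⟨_, h⟩

theorem dec_ext {l : D.Path} (x : NodeModel hN (Λ.dec l).1 (Λ.dec l).2) (hx : IsNode L x.1)
    (h : D.IsPath (D.ext l.1 (Λ.emb _ x))) : Λ.dec ⟨_, h⟩ = ⟨x.1, hx⟩ :=
  Λ.next _ x hx

theorem isPath_ext {l : D.Path} (x : NodeModel hN (Λ.dec l).1 (Λ.dec l).2) (hx : IsNode L x.1) :
    D.IsPath (D.ext l.1 (Λ.emb _ x)) := by
  rw [TreeData.isPath_ext_iff]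
  exact (embedding_mem_predSet (Λ.emb (D.state l.1))).2 ((mem_predSet_iff x).2 hx)

/-- Induction on the level of `u`: the starting label has level 0 and so is the unique root, and the
code of a predecessor is prolonged by the image of `u`. -/
theorem exists_legit (u : {u : N // IsNode L u}) : ∃ l, Λ.Legit l ∧ Λ.dec l = u := by
  have h := models_starSentence_iff.1 hN
  obtain ⟨u, hu⟩ := u
  obtain ⟨m, hm⟩ := h.exists_level u hu
  induction m generalizing u with
  | zero =>
    obtain ⟨r, -, hr⟩ := h.root
    exact ⟨_, .nil, Subtype.ext ((hr _ Λ.start).trans (hr _ hm).symm)⟩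
  | succ m ih =>
    obtain ⟨t, ht, hm⟩ := hm
    obtain ⟨l, hl, hdec⟩ := ih t (h.R_sort _ _ ht).1 hm
    let x : NodeModel hN (Λ.dec l).1 (Λ.dec l).2 := ⟨u, by rw [hdec]; exact ((h.R_iff _ _).1 ht).1⟩
    exact ⟨_, .ext hl x hu (Λ.isPath_ext x hu), Λ.dec_ext x hu _⟩

theorem not_inModel_start (u : N) : ¬ InModel L u (Λ.label D.start).1 := fun h =>
  Λ.start.2 ⟨u, ((models_starSentence_iff.1 hN).R_iff _ _).2 ⟨h, Λ.start.1⟩⟩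

/-- A non-root node lies in only one attached model, so its label determines the previous label and
the last letter. Off legitimate paths injectivity can fail, because letters outside the image of the
embedding carry unconstrained labels. -/
theorem dec_injOn {l t : D.Path} (hl : Λ.Legit l) (ht : Λ.Legit t) (h : Λ.dec l = Λ.dec t) :
    l = t := by
  have hS := models_starSentence_iff.1 hN
  induction hl generalizing t with
  | nil =>
    cases ht with
    | nil => rfl
    | ext ht x hx hp =>
      rw [Λ.dec_ext x hx] at h
      exact absurd (congrArg Subtype.val h ▸ x.2) (Λ.not_inModel_start _)
  | @ext l hl y hy hq ih =>
    rw [Λ.dec_ext y hy] at h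
    cases ht with
    | nil => exact absurd (congrArg Subtype.val h ▸ y.2) (Λ.not_inModel_start _)
    | @ext t ht x hx hp =>
      rw [Λ.dec_ext x hx] at h
      have hxy : y.1 = x.1 := congrArg Subtype.val h
      obtain rfl := ih ht (Subtype.ext (hS.M_disjoint _ _ _ y.2 (hxy ▸ x.2)))
      obtain rfl : y = x := Subtype.ext hxy
      rfl

/-- The path that codes a node of `N`. -/
noncomputable def enc (u : {u : N // IsNode L u}) : D.Path := (Λ.exists_legit u).choose

theorem legit_enc (u : {u : N // IsNode L u}) : Λ.Legit (Λ.enc u) :=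
  (Λ.exists_legit u).choose_spec.1

theorem dec_enc (u : {u : N // IsNode L u}) : Λ.dec (Λ.enc u) = u :=
  (Λ.exists_legit u).choose_spec.2

theorem enc_dec {l : D.Path} (hl : Λ.Legit l) : Λ.enc (Λ.dec l) = l :=
  Λ.dec_injOn (Λ.legit_enc _) hl (Λ.dec_enc _)

theorem enc_injective : Function.Injective Λ.enc :=
  Function.LeftInverse.injective Λ.dec_enc

theorem exists_emb (u : {u : N // IsNode L u}) :
    ∃ g : NodeModel hN u.1 u.2 ↪[L] D.Model (D.state (Λ.enc u).1), φ.IsElementary g ∧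
      ∀ x (hx : IsNode L x.1), D.ext (Λ.enc u).1 (g x) = (Λ.enc ⟨x.1, hx⟩).1 := by
  -- The type of the embedding depends on `Λ.dec (Λ.enc u)`, which equals `u` only propositionally.
  -- Generalizing over `l` lets the equation be eliminated.
  have key : ∀ (l : D.Path) (u : {u : N // IsNode L u}), Λ.Legit l → Λ.dec l = u →
      ∃ g : NodeModel hN u.1 u.2 ↪[L] D.Model (D.state l.1), φ.IsElementary g ∧
      ∀ x (hx : IsNode L x.1), D.ext l.1 (g x) = (Λ.enc ⟨x.1, hx⟩).1 := by
    rintro l _ hl rfl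
    refine ⟨Λ.emb _, Λ.elementary _, fun x hx => ?_⟩
    have hp := Λ.isPath_ext x hx
    rw [← Λ.dec_ext x hx hp, Λ.enc_dec (.ext hl x hx hp)]
    rfl
  exact key _ u (Λ.legit_enc u) (Λ.dec_enc u)

/-- The embedding of the model attached to the node `u`. -/
noncomputable def nodeEmb (u : {u : N // IsNode L u}) :
    NodeModel hN u.1 u.2 ↪[L] D.Model (D.state (Λ.enc u).1) := (Λ.exists_emb u).choose

theorem elementary_nodeEmb (u : {u : N // IsNode L u}) : φ.IsElementary (Λ.nodeEmb u) :=
  (Λ.exists_emb u).choose_spec.1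

theorem ext_nodeEmb (u : {u : N // IsNode L u}) (x : NodeModel hN u.1 u.2) (hx : IsNode L x.1) :
    D.ext (Λ.enc u).1 (Λ.nodeEmb u x) = (Λ.enc ⟨x.1, hx⟩).1 :=
  (Λ.exists_emb u).choose_spec.2 x hx

theorem nodeEmb_mem_predSet {u : {u : N // IsNode L u}} {x : NodeModel hN u.1 u.2} :
    Λ.nodeEmb u x ∈ predSet p _ ↔ IsNode L x.1 :=
  (embedding_mem_predSet _).trans (mem_predSet_iff x)

theorem ext_enc_of_rRel {u t : {u : N // IsNode L u}} (h : RRel L u.1 t.1) :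
    ∃ a, D.ext (Λ.enc u).1 a = (Λ.enc t).1 :=
  ⟨_, Λ.ext_nodeEmb u ⟨t.1, (((models_starSentence_iff.1 hN).R_iff _ _).1 h).1⟩ t.2⟩

theorem length_enc {u : {u : N // IsNode L u}} {m : ℕ} :
    (Λ.enc u).1.length = m ↔ HasLevel L m u.1 := by
  have h := models_starSentence_iff.1 hN
  have key : ∀ (m : ℕ) (u : {u : N // IsNode L u}), HasLevel L m u.1 →
      (Λ.enc u).1.length = m := by
    intro m
    induction m with
    | zero =>
      intro u hu
      obtain ⟨r, -, hr⟩ := h.root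
      have : Λ.dec ⟨[], .nil⟩ = u := Subtype.ext ((hr _ Λ.start).trans (hr _ hu).symm)
      rw [← this, Λ.enc_dec .nil]
      rfl
    | succ m ih =>
      rintro u ⟨t, ht, hm⟩
      obtain ⟨a, ha⟩ := Λ.ext_enc_of_rRel (u := ⟨t, (h.R_sort _ _ ht).1⟩) ht
      rw [← ha, TreeData.ext, List.length_cons, ih _ hm]
  refine ⟨?_, key m u⟩
  rintro rfl
  obtain ⟨m, hm⟩ := h.exists_level u.1 u.2
  rwa [key m u hm]

theorem exists_branch (hinf : ∀ (M : Type u) [L.Structure M], φ.Models M → (predSet p M).Infinite)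
    {f : N} (hf : IsF L f) : ∃ b : D.Branch, ∀ (n : ℕ) (k : N) (x : {u : N // IsNode L u}),
      HasNum L n k → ERel L k f x.1 → b.toFun n = Λ.enc x := by
  have h := models_starSentence_iff.1 hN
  choose k hk hk' using h.exists_num
  choose x hx hx' using fun n => h.E_exists (k n) f (hk n).1 hf
  have hnode : ∀ n, IsNode L (x n) := fun n => (h.E_sort _ _ _ (hx n)).2.2
  have hlev : ∀ n, HasLevel L n (x n) := fun n => ((hk n).2 _).1 (h.E_level _ _ _ (hx n))
  have hR : ∀ n, RRel L (x n) (x (n + 1)) := by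
    intro n
    -- The axiom on consecutive values of a branch applies only when some successor of `x n`
    -- witnesses that `k (n + 1)` is the next level; `P` being nonempty supplies one.
    obtain ⟨z, hz⟩ := (hinf _ (models_nodeModel hN (x n) (hnode n))).nonempty
    have hxz : RRel L (x n) z.1 := (h.R_iff _ _).2 ⟨z.2, (mem_predSet_iff z).1 hz⟩
    exact h.E_step _ _ _ _ _ _ (hx n) (hx (n + 1)) hxz
      (((hk (n + 1)).2 _).2 ⟨_, hxz, hlev n⟩)
  refine ⟨⟨fun n => Λ.enc ⟨x n, hnode n⟩, fun n => Λ.length_enc.2 (hlev n), fun n => ?_⟩, ?_⟩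
  · obtain ⟨a, ha⟩ := Λ.ext_enc_of_rRel (u := ⟨x n, hnode n⟩) (t := ⟨x (n + 1), hnode _⟩) (hR n)
    rw [← ha]
    rfl
  · intro n l y hl hy
    obtain rfl := hk' n l hl
    exact congrArg Λ.enc (Subtype.ext (hx' n y.1 hy).symm)

/-- The map `f` sends numbers to numbers, branches to branches, and nodes and elements of attached
models to their codes. -/
structure IsCoding (f : N → D.Point) : Prop where
  num : ∀ k, IsK L k → ∃ n, HasNum L n k ∧ f k = .num n
  branch : ∀ g, IsF L g → ∃ b, f g = .branch b ∧
    ∀ (n : ℕ) (k : N) (x : {u : N // IsNode L u}), HasNum L n k → ERel L k g x.1 →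
      b.toFun n = Λ.enc x
  node : ∀ u : {u : N // IsNode L u}, f u.1 = TreeData.node (Λ.enc u)
  child : ∀ (u : {u : N // IsNode L u}) (x : NodeModel hN u.1 u.2),
    f x.1 = TreeData.child (Λ.enc u) (Λ.nodeEmb u x)

theorem exists_isCoding
    (hinf : ∀ (M : Type u) [L.Structure M], φ.Models M → (predSet p M).Infinite) :
    ∃ f, Λ.IsCoding f := by
  classical
  have h := models_starSentence_iff.1 hN
  choose ν hν using h.hasNum
  choose β hβ using fun (g : N) (hg : IsF L g) => Λ.exists_branch hinf hg
  refine ⟨fun x => if hK : IsK L x then .num (ν x hK) else if hF : IsF L x then .branch (β x hF) else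
    if hV : IsNode L x then TreeData.node (Λ.enc ⟨x, hV⟩) else
    -- The final default is never reached, since the sorts and the attached models cover `N`.
    if hM : ∃ (u : {u : N // IsNode L u}), InModel L u.1 x then
      TreeData.child (Λ.enc hM.choose) (Λ.nodeEmb hM.choose ⟨x, hM.choose_spec⟩) else .num 0,
    fun k hk => ⟨ν k hk, hν k hk, dif_pos hk⟩, fun g hg => ⟨β g hg, ?_, hβ g hg⟩, fun u => ?_,
    fun u x => ?_⟩
  · rw [dif_neg fun hk => h.not_K_F g hk hg, dif_pos hg]
  · rw [dif_neg fun hk => h.not_K_V _ hk u.2, dif_neg (h.not_V_F _ u.2), dif_pos u.2]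
  · obtain ⟨-, hK, hF⟩ := h.M_sort _ _ x.2
    rw [dif_neg hK, dif_neg hF]
    split_ifs with hV hM
    -- A node inside an attached model is coded in two ways, as a node and as an element; the codes
    -- agree by `ext_nodeEmb`.
    · exact (TreeData.child_eq_node.2 (Λ.ext_nodeEmb u x hV)).symm
    -- The chosen node must be `u`, because attached models are disjoint.
    · have : ∀ (t : {u : N // IsNode L u}) (ht : InModel L t.1 x.1),
          TreeData.child (Λ.enc t) (Λ.nodeEmb t ⟨x.1, ht⟩) =
            TreeData.child (Λ.enc u) (Λ.nodeEmb u x) := by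
        intro t ht
        obtain rfl : t = u := Subtype.ext (h.M_disjoint _ _ _ ht x.2)
        rfl
      exact this _ _
    · exact absurd ⟨u, x.2⟩ hM

/-! ### A coding preserves and reflects the structure. -/

namespace IsCoding

variable {Λ} {f : N → D.Point} (hf : Λ.IsCoding f)

include hf

theorem cases (x : N) :
    (IsK L x ∧ ∃ n, HasNum L n x ∧ f x = .num n) ∨ (IsF L x ∧ ∃ b, f x = .branch b) ∨
    (∃ hx : IsNode L x, f x = TreeData.node (Λ.enc ⟨x, hx⟩)) ∨
    ∃ (u : {u : N // IsNode L u}) (y : NodeModel hN u.1 u.2), x = y.1 := by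
  have h := models_starSentence_iff.1 hN
  rcases h.cover x with hx | hx | hx | ⟨u, hx⟩
  · exact Or.inl ⟨hx, hf.num x hx⟩
  · exact Or.inr (Or.inr (Or.inl ⟨hx, hf.node ⟨x, hx⟩⟩))
  · obtain ⟨b, hb, -⟩ := hf.branch x hx
    exact Or.inr (Or.inl ⟨hx, b, hb⟩)
  · exact Or.inr (Or.inr (Or.inr ⟨⟨u, (h.M_sort _ _ hx).1⟩, ⟨x, hx⟩, rfl⟩))

theorem exists_of_num {x : N} {n : ℕ} (h : f x = .num n) : HasNum L n x := by
  rcases hf.cases x with ⟨-, m, hm, h'⟩ | ⟨-, b, h'⟩ | ⟨hx, h'⟩ | ⟨u, y, rfl⟩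
  · rw [h] at h'
    cases h'
    exact hm
  · rw [h] at h'; cases h'
  · rw [h] at h'; cases h'
  · rw [hf.child] at h; cases h

theorem isF_of_branch {x : N} {b : D.Branch} (h : f x = .branch b) : IsF L x := by
  rcases hf.cases x with ⟨-, m, hm, h'⟩ | ⟨hx, -⟩ | ⟨hx, h'⟩ | ⟨u, y, rfl⟩
  · rw [h] at h'; cases h'
  · exact hx
  · rw [h] at h'; cases h'
  · rw [hf.child] at h; cases h

theorem exists_of_node {x : N} {l : D.Path} (h : f x = TreeData.node l) :
    ∃ hx : IsNode L x, l = Λ.enc ⟨x, hx⟩ := by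
  have hx : IsNode L x := by
    rcases hf.cases x with ⟨-, m, hm, h'⟩ | ⟨-, b, h'⟩ | ⟨hx, -⟩ | ⟨u, y, rfl⟩
    · rw [h] at h'; cases h'
    · rw [h] at h'; cases h'
    · exact hx
    · rw [hf.child] at h
      -- An element sent to a tree node lands in `P`, and embeddings reflect `P`, so it was already
      -- a node.
      exact Λ.nodeEmb_mem_predSet.1 (TreeData.child_mem_range_node.1 ⟨_, h⟩)
  exact ⟨hx, (TreeData.node_inj.1 ((hf.node ⟨x, hx⟩).symm.trans h)).symm⟩

theorem inModel_of_child {u : {u : N // IsNode L u}} {x : N} {a : D.Model (D.state (Λ.enc u).1)}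
    (h : f x = TreeData.child (Λ.enc u) a) : InModel L u.1 x := by
  have hS := models_starSentence_iff.1 hN
  have key : ∀ (t : {u : N // IsNode L u}) (y : NodeModel hN t.1 t.2),
      f y.1 = TreeData.child (Λ.enc u) a → InModel L u.1 y.1 := by
    intro t y h
    rw [hf.child] at h
    rw [← Λ.enc_injective (TreeData.path_eq_of_child_eq h)]
    exact y.2
  rcases hf.cases x with ⟨-, m, hm, h'⟩ | ⟨-, b, h'⟩ | ⟨hx, h'⟩ | ⟨t, y, rfl⟩
  · rw [h] at h'; cases h'
  · rw [h] at h'; cases h'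
  -- The root is excluded because its code is empty; any other node is also an element of its
  -- predecessor's model, which reduces the claim to `key`.
  · obtain ⟨m, hm⟩ := hS.exists_level x hx
    cases m with
    | zero =>
      have h1 := (Λ.length_enc (u := ⟨x, hx⟩)).2 hm
      rw [← TreeData.child_eq_node.1 (h.symm.trans h')] at h1
      simp [TreeData.ext] at h1
    | succ m =>
      obtain ⟨t, ht, -⟩ := hm
      exact key ⟨t, (hS.R_sort _ _ ht).1⟩ ⟨x, ((hS.R_iff _ _).1 ht).1⟩ h
  · exact key t y h

theorem isK_iff (x : N) : IsK L (f x) ↔ IsK L x := by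
  constructor
  · rintro ⟨n, h⟩
    exact (hf.exists_of_num h).1
  · intro h
    obtain ⟨n, -, h⟩ := hf.num x h
    exact ⟨n, h⟩

theorem isNode_iff (x : N) : IsNode L (f x) ↔ IsNode L x := by
  constructor
  · rintro ⟨l, h⟩
    exact (hf.exists_of_node h).1
  · intro h
    exact ⟨_, hf.node ⟨x, h⟩⟩

theorem isF_iff (x : N) : IsF L (f x) ↔ IsF L x := by
  constructor
  · rintro ⟨b, h⟩
    exact hf.isF_of_branch h
  · intro h
    obtain ⟨b, hb, -⟩ := hf.branch x h
    exact ⟨b, hb⟩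

theorem inModel_iff (u x : N) : InModel L (f u) (f x) ↔ InModel L u x := by
  constructor
  · rintro ⟨l, a, hu', hx⟩
    obtain ⟨hu, rfl⟩ := hf.exists_of_node hu'
    exact hf.inModel_of_child (u := ⟨u, hu⟩) hx
  · intro h
    have hu : IsNode L u := ((models_starSentence_iff.1 hN).M_sort _ _ h).1
    exact ⟨_, _, hf.node ⟨u, hu⟩, hf.child ⟨u, hu⟩ ⟨x, h⟩⟩

theorem rRel_iff (x y : N) : RRel L (f x) (f y) ↔ RRel L x y := by
  rw [TreeData.rRel_iff, (models_starSentence_iff.1 hN).R_iff, hf.inModel_iff, hf.isNode_iff]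

theorem hRel_iff (k x : N) : HRel L (f k) (f x) ↔ HRel L k x := by
  have key : ∀ (n : ℕ) (x : {u : N // IsNode L u}), HasNum L n k →
      ((Λ.enc x).1.length = n ↔ HRel L k x.1) := fun n x hn =>
    Λ.length_enc.trans (hn.2 _).symm
  constructor
  · rintro ⟨l, hk, hx'⟩
    obtain ⟨hx, rfl⟩ := hf.exists_of_node hx'
    exact (key _ ⟨x, hx⟩ (hf.exists_of_num hk)).1 rfl
  · intro h
    obtain ⟨hk, hx⟩ := (models_starSentence_iff.1 hN).H_sort _ _ h
    obtain ⟨n, hn, hfk⟩ := hf.num k hk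
    refine ⟨_, ?_, hf.node ⟨x, hx⟩⟩
    exact hfk.trans (congrArg _ ((key n ⟨x, hx⟩ hn).2 h).symm)

theorem eRel_iff (k g x : N) : ERel L (f k) (f g) (f x) ↔ ERel L k g x := by
  have hS := models_starSentence_iff.1 hN
  constructor
  · rintro ⟨n, b, hk, hg, hx⟩
    obtain ⟨hx, hb⟩ := hf.exists_of_node hx
    have hn := hf.exists_of_num hk
    have hF := hf.isF_of_branch hg
    obtain ⟨b', hg', hb'⟩ := hf.branch g hF
    obtain rfl : b = b' := TreeData.Point.branch.inj (hg.symm.trans hg')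
    obtain ⟨y, hy, -⟩ := hS.E_exists k g hn.1 hF
    have h1 := hb' n k ⟨y, (hS.E_sort _ _ _ hy).2.2⟩ hn hy
    obtain rfl : x = y := congrArg Subtype.val (Λ.enc_injective (hb.symm.trans h1))
    exact hy
  · intro h
    obtain ⟨hk, hg, hx⟩ := hS.E_sort _ _ _ h
    obtain ⟨n, hn, hfk⟩ := hf.num k hk
    obtain ⟨b, hg', hb⟩ := hf.branch g hg
    refine ⟨n, b, hfk, hg', ?_⟩
    rw [hb n k ⟨x, hx⟩ hn h]
    exact hf.node ⟨x, hx⟩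

theorem comp_cons (u : {u : N // IsNode L u}) {k : ℕ} (x : Fin k → NodeModel hN u.1 u.2) :
    f ∘ (Fin.cons u.1 fun i => (x i).1 : Fin (k + 1) → N) =
      Fin.cons (TreeData.node (Λ.enc u)) fun i => TreeData.child (Λ.enc u) (Λ.nodeEmb u (x i)) := by
  funext i
  refine Fin.cases (hf.node u) (fun i => hf.child u (x i)) i

theorem sort_iff {k : ℕ} (x : Fin (k + 1) → N) :
    (IsNode L ((f ∘ x) 0) ∧ ∀ i : Fin k, InModel L ((f ∘ x) 0) ((f ∘ x) i.succ)) ↔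
      IsNode L (x 0) ∧ ∀ i : Fin k, InModel L (x 0) (x i.succ) := by
  simp only [Function.comp_apply, hf.isNode_iff, hf.inModel_iff]

/-- Truth on either side forces all arguments into a single attached model, and there the claim is
that `nodeEmb` is an embedding. -/
theorem lift_iff {k : ℕ} (S : L.Relations k) (x : Fin (k + 1) → N) :
    Structure.RelMap (L := starLang L) (n := k + 1) (StarRelations.lift S) (f ∘ x) ↔
      Structure.RelMap (L := starLang L) (n := k + 1) (StarRelations.lift S) x := by
  have key : (IsNode L (x 0) ∧ ∀ i : Fin k, InModel L (x 0) (x i.succ)) →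
      (Structure.RelMap (L := starLang L) (n := k + 1) (StarRelations.lift S) (f ∘ x) ↔
      Structure.RelMap (L := starLang L) (n := k + 1) (StarRelations.lift S) x) := by
    rintro ⟨h0, h1⟩
    let u : {u : N // IsNode L u} := ⟨x 0, h0⟩
    let y : Fin k → NodeModel hN u.1 u.2 := fun i => ⟨x i.succ, h1 i⟩
    have hx : x = Fin.cons u.1 fun i => (y i).1 := (Fin.cons_self_tail x).symm
    rw [hx, hf.comp_cons, (TreeData.isAttached_child _).rel_iff]
    exact (Λ.nodeEmb u).map_rel S y
  constructor
  · intro h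
    exact (key ((hf.sort_iff x).1 (TreeData.isStarModel.rel_sort k S _ h))).1 h
  · intro h
    exact (key ((models_starSentence_iff.1 hN).rel_sort k S _ h)).2 h

theorem map_fun {k : ℕ} (g : L.Functions k) (x : Fin (k + 1) → N) :
    f (Structure.funMap (L := starLang L) (n := k + 1) (StarFunctions.lift g) x) =
      Structure.funMap (L := starLang L) (n := k + 1) (StarFunctions.lift g) (f ∘ x) := by
  by_cases h : IsNode L (x 0) ∧ ∀ i : Fin k, InModel L (x 0) (x i.succ)
  · obtain ⟨h0, h1⟩ := h
    let u : {u : N // IsNode L u} := ⟨x 0, h0⟩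
    let y : Fin k → NodeModel hN u.1 u.2 := fun i => ⟨x i.succ, h1 i⟩
    have hx : x = Fin.cons u.1 fun i => (y i).1 := (Fin.cons_self_tail x).symm
    rw [hx, hf.comp_cons, (TreeData.isAttached_child _).fun_eq]
    have := (Λ.nodeEmb u).map_fun g y
    refine Eq.trans ?_ (congrArg _ this)
    exact hf.child u (Structure.funMap g y)
  -- Ill-sorted arguments remain ill-sorted under `f`, and both functions then return their first
  -- argument.
  · rw [(models_starSentence_iff.1 hN).fun_junk k g x h,
      TreeData.isStarModel.fun_junk k g _ (fun h' => h ((hf.sort_iff x).1 h'))]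
    rfl

theorem injective : Function.Injective f := by
  have hS := models_starSentence_iff.1 hN
  have hnode : ∀ (u : {u : N // IsNode L u}) (y : N), f u.1 = f y → u.1 = y := by
    intro u y h
    obtain ⟨hy, h'⟩ := hf.exists_of_node (h.symm.trans (hf.node u))
    exact congrArg Subtype.val (Λ.enc_injective h')
  have hchild : ∀ (u : {u : N // IsNode L u}) (x : NodeModel hN u.1 u.2) (y : N),
      f x.1 = f y → x.1 = y := by
    intro u x y h
    have hy := hf.inModel_of_child (h.symm.trans (hf.child u x))
    have h' := (hf.child u x).symm.trans (h.trans (hf.child u ⟨y, hy⟩))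
    exact congrArg Subtype.val ((Λ.nodeEmb u).injective (TreeData.child_injective _ h'))
  intro x y h
  rcases hf.cases x with ⟨-, n, hn, h'⟩ | ⟨hx, b, h'⟩ | ⟨hx, -⟩ | ⟨u, z, rfl⟩
  · have := hf.exists_of_num (h.symm.trans h')
    obtain ⟨k, -, hk⟩ := hS.exists_num n
    rw [hk x hn, hk y this]
  · have hy := hf.isF_of_branch (h.symm.trans h')
    by_contra hne
    -- Branches that differ are separated by `E`, which the coding preserves and reflects, so they
    -- cannot share an image.
    obtain ⟨k, v, h1, h2⟩ := hS.F_ext x y hx hy hne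
    rw [← hf.eRel_iff, ← h, hf.eRel_iff] at h2
    exact h2 h1
  · exact hnode ⟨x, hx⟩ y h
  · exact hchild u z y h

end IsCoding

/-- A coding as an embedding of structures. -/
def IsCoding.toEmbedding {f : N → D.Point} (hf : Λ.IsCoding f) : N ↪[starLang L] D.Point where
  toFun := f
  inj' := hf.injective
  map_fun' {_} g x := by
    cases g with
    | lift g => exact hf.map_fun g x
  map_rel' {_} S x := by
    cases S with
    | lift S => exact hf.lift_iff S x
    | K =>
      rw [show x = ![x 0] by funext i; fin_cases i; rfl]
      exact Iff.trans (iff_of_eq (congrArg _ (by funext i; fin_cases i; rfl)))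
        (hf.isK_iff (x 0))
    | V =>
      rw [show x = ![x 0] by funext i; fin_cases i; rfl]
      exact Iff.trans (iff_of_eq (congrArg _ (by funext i; fin_cases i; rfl)))
        (hf.isNode_iff (x 0))
    | F =>
      rw [show x = ![x 0] by funext i; fin_cases i; rfl]
      exact Iff.trans (iff_of_eq (congrArg _ (by funext i; fin_cases i; rfl)))
        (hf.isF_iff (x 0))
    | H =>
      rw [show x = ![x 0, x 1] by funext i; fin_cases i <;> rfl]
      exact Iff.trans (iff_of_eq (congrArg _ (by funext i; fin_cases i <;> rfl)))
        (hf.hRel_iff (x 0) (x 1))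
    | R =>
      rw [show x = ![x 0, x 1] by funext i; fin_cases i <;> rfl]
      exact Iff.trans (iff_of_eq (congrArg _ (by funext i; fin_cases i <;> rfl)))
        (hf.rRel_iff (x 0) (x 1))
    | M =>
      rw [show x = ![x 0, x 1] by funext i; fin_cases i <;> rfl]
      exact Iff.trans (iff_of_eq (congrArg _ (by funext i; fin_cases i <;> rfl)))
        (hf.inModel_iff (x 0) (x 1))
    | E =>
      rw [show x = ![x 0, x 1, x 2] by funext i; fin_cases i <;> rfl]
      exact Iff.trans (iff_of_eq (congrArg _ (by funext i; fin_cases i <;> rfl)))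
        (hf.eRel_iff (x 0) (x 1) (x 2))

theorem exists_strong (Λ : Labelling D hN)
    (hinf : ∀ (M : Type u) [L.Structure M], φ.Models M → (predSet p M).Infinite) :
    ∃ f : N ↪[starLang L] D.Point, (starClass φ p).Strong hN
      (models_starSentence_iff.2 TreeData.isStarModel) f := by
  obtain ⟨f, hf⟩ := Λ.exists_isCoding hinf
  refine ⟨hf.toEmbedding, fun u hu n a ha x => ?_⟩
  -- The model attached in the tree is a subtype of points, not literally `D.Model _`. Relativized
  -- formulas evaluate identically in both presentations, so elementarity of `nodeEmb` transfers.
  rw [← Λ.elementary_nodeEmb ⟨u, hu⟩ a ha x, ← (TreeData.isAttached_child _).realize_relativize,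
    ← (isAttached_nodeModel _ _ _).realize_relativize]
  refine iff_of_eq (congrArg _ ?_)
  refine Eq.trans ?_ (hf.comp_cons ⟨u, hu⟩ x)
  funext i
  refine Fin.cases rfl (fun i => rfl) i

end Labelling

end LabelledTrees

/-! ## Joint embedding -/

section JointEmbedding

open Star InfFormula

variable {L : FirstOrder.Language.{v, w}} [Countable (Σ k, L.Functions k)]
  [Countable (Σ k, L.Relations k)] {φ : InfFormula L 0} {p : L.Relations 1}

/-- Supplies one coordinate of the successor state. Elements not coming from a node are given `u`
itself, an arbitrary choice that no `Labelling` condition mentions. -/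
theorem exists_node_leftInverse {N A : Type u} [(starLang L).Structure N] [L.Structure A]
    {hN : (starSentence φ p).Models N} {u : N} {hu : IsNode L u} (g : NodeModel hN u hu ↪[L] A) :
    ∃ n : A → {u : N // IsNode L u}, ∀ x (hx : IsNode L x.1), n (g x) = ⟨x.1, hx⟩ := by
  classical
  refine ⟨fun a => if h : ∃ x, IsNode L x.1 ∧ g x = a then ⟨h.choose.1, h.choose_spec.1⟩
    else ⟨u, hu⟩, fun x hx => ?_⟩
  have h : ∃ y, IsNode L y.1 ∧ g y = g x := ⟨x, hx, rfl⟩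
  refine (dif_pos h).trans (Subtype.ext ?_)
  exact congrArg (fun z : NodeModel hN u hu => z.1) (g.injective h.choose_spec.2)

end JointEmbedding

theorem mainTheorem12 {L : FirstOrder.Language.{v, w}}
    [Countable (Σ k, L.Functions k)] [Countable (Σ k, L.Relations k)]
    (κ : Cardinal.{u}) (φ : InfFormula L 0) (P : L.Relations 1)
    (hφ : HomogeneouslyCharacterizes φ P κ)
    (hJEP : (modelClass.{u} φ).JEPBelow κ) :
    (starClass.{u} φ P).JEPBelow κ := by
  intro M₀ M₁ _ _ h₀ h₁ hκ₀ hκ₁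
  replace h₀ : (starSentence φ P).Models M₀ := h₀
  replace h₁ : (starSentence φ P).Models M₁ := h₁
  have hinf : ∀ (M : Type u) [L.Structure M], φ.Models M → (predSet P M).Infinite :=
    fun M _ hM => hφ.predSet_infinite hM
  obtain ⟨r₀, hr₀, -⟩ := (Star.models_starSentence_iff.1 h₀).root
  obtain ⟨r₁, hr₁, -⟩ := (Star.models_starSentence_iff.1 h₁).root
  -- Joint embedding is applied to all pairs of nodes, reachable or not, so that the attached model
  -- depends on the state alone.
  choose A str hA g₀ g₁ hg₀ hg₁ using fun s : {u : M₀ // IsNode L u} × {u : M₁ // IsNode L u} =>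
    hJEP (NodeModel h₀ s.1.1 s.1.2) (NodeModel h₁ s.2.1 s.2.2)
      (Star.models_nodeModel h₀ s.1.1 s.1.2) (Star.models_nodeModel h₁ s.2.1 s.2.2)
      ((mk_subtype_le _).trans_lt hκ₀) ((mk_subtype_le _).trans_lt hκ₁)
  choose n₀ hn₀ using fun s => exists_node_leftInverse (g₀ s)
  choose n₁ hn₁ using fun s => exists_node_leftInverse (g₁ s)
  let D : TreeData φ P :=
    { State := {u : M₀ // IsNode L u} × {u : M₁ // IsNode L u}
      start := (⟨r₀, hr₀.1⟩, ⟨r₁, hr₁.1⟩)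
      Model := A
      str := str
      models := hA
      infinite := fun s => hinf (A s) (hA s)
      -- The coordinates are decoded independently, so each projection of the state is a labelling
      -- by its own model.
      next := fun y => (n₀ y.1 y.2, n₁ y.1 y.2) }
  let Λ₀ : Labelling D h₀ :=
    { label := Prod.fst, emb := g₀, elementary := hg₀, start := hr₀, next := hn₀ }
  let Λ₁ : Labelling D h₁ :=
    { label := Prod.snd, emb := g₁, elementary := hg₁, start := hr₁, next := hn₁ }
  obtain ⟨f₀, hf₀⟩ := Λ₀.exists_strong hinf
  obtain ⟨f₁, hf₁⟩ := Λ₁.exists_strong hinf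
  exact ⟨D.Point, inferInstance, Star.models_starSentence_iff.2 TreeData.isStarModel, f₀, f₁,
    hf₀, hf₁⟩
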